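/- Let $X,Y,A,B$ be finite sets and let $M=(M_{x,y}^{a,b})_{x\in X,y\in Y,a\in A,b\in B}$ be a Bell functional, i.e. a family of real coefficients. For $P=(P(a,b|x,y))$ real put $\omega(M;P)=\sum_{x,y,a,b}M_{x,y}^{a,b}P(a,b|x,y)$, and define $$\omega_{inc}(M)=\sup_{P}|\omega(M;P)|,\qquad \omega^*_{inc}(M)=\sup_{Q}|\omega(M;Q)|,$$ where * $P$ ranges over the convex hull of the products $p(a|x)\,q(b|y)$ of incomplete conditional distributions: $p(a|x)\ge 0$, $\sum_a p(a|x)\le 1$ for all $x$, and $q(b|y)\ge 0$, $\sum_b q(b|y)\le 1$ for all $y$; * $Q$ ranges over the families $Q(a,b|x,y)=\langle\psi|E_x^a\otimes F_y^b|\psi\rangle$ with $d\in\mathbb N$, $\psi$ in the closed unit ball of $\mathbb C^d\otimes\mathbb C^d$, and positive semidefinite $E_x^a,F_y^b\in M_d=M_d(\mathbb C)$ such that $\sum_a E_x^a\le \mathrm{Id}$ for all $x$ and $\sum_b F_y^b\le \mathrm{Id}$ for all $y$. Let $\hat M=\sum_{x,y,a,b}M_{x,y}^{a,b}\,(e_x\otimes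 e_a)\otimes(e_y\otimes e_b)$ be the associated tensor. Then $\omega_{inc}(M)$ and $\omega^*_{inc}(M)$ are finite, and $$\omega_{inc}(M)\le\|\hat M\|_{\ell_1^X(\ell_\infty^A(\mathbb R))\otimes_\epsilon\ell_1^Y(\ell_\infty^B(\mathbb R))}\le 4\,\omega_{inc}(M),$$ $$\omega^*_{inc}(M)\le\|\hat M\|_{\ell_1^X(\ell_\infty^A)\otimes_{min}\ell_1^Y(\ell_\infty^B)}\le 4\,\omega^*_{inc}(M).$$ In the first line the spaces are real, $\ell_1^X(\ell_\infty^A(\mathbb R))$ is $\mathbb R^{X\times A}$ with norm $\sum_x\max_a|r(x,a)|$, and the injective norm of $z\in E\otimes F$ is $\|z\|_\epsilon=\sup|\langle z,\varphi\otimes\chi\rangle|$ over $\varphi,\chi$ in the closed unit balls of $E^*,F^*$. In the second line the spaces are complex operator spaces and $\|z\|_{min}=\sup\|(T\otimes S)(z)\|_{M_{d^2}}$ over all $d\in\mathbb N$ and all linear maps $T:E\to M_d$, $S:F\to M_d$ with $\|T\|_{cb},\|S\|_{cb}\le1$. Here $\|T\|_{cb}=\sup_n\|T_n:M_n(E)\to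 M_n(M_d)\|$, where $T_n$ applies $T$ to every entry and $M_n(M_d)=M_{nd}$ carries the operator norm. The operator space structures are the standard ones: for an operator space $V$, the norm of $M_n(\ell_\infty^I(V))$ is the maximum over $i\in I$ of the norms in $M_n(V)$ of the components, with $\ell_\infty^A=\ell_\infty^A(\mathbb C)$; the norm of $x\in M_n(V^*)$ is the cb-norm of the associated map $V\to M_n$, $v\mapsto(x_{ij}(v))_{ij}$; and, with respect to the canonical pairings, $\ell_1^A=(\ell_\infty^A)^*$ and $\ell_1^X(\ell_\infty^A)=(\ell_\infty^X(\ell_1^A))^*$. -/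

import Mathlib

open scoped TensorProduct Kronecker ENNReal ComplexOrder Matrix.Norms.L2Operator

/-! ### Bell functionals and their incomplete values -/

/-- A Bell functional with (finite) input sets `X`, `Y` and output sets `A`, `B`, given by its real
coefficients `M x y a b`. -/
abbrev BellFunctional (X Y A B : Type*) := X → Y → A → B → ℝ

/-- The action of a Bell functional on a family `P x y a b = P(a, b | x, y)`. -/
def BellFunctional.eval {X Y A B : Type*} [Fintype X] [Fintype Y] [Fintype A] [Fintype B]
    (M : BellFunctional X Y A B) (P : X → Y → A → B → ℝ) : ℝ :=
  ∑ x, ∑ y, ∑ a, ∑ b, M x y a b * P x y a b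

/-- Incomplete conditional distributions `p x a = p(a | x)` from `X` to `A`. -/
def incompleteDist (X A : Type*) [Fintype A] : Set (X → A → ℝ) :=
  {p | (∀ x a, 0 ≤ p x a) ∧ ∀ x, ∑ a, p x a ≤ 1}

/-- The convex hull of the products of incomplete conditional distributions. -/
def incompleteClassical (X Y A B : Type*) [Fintype A] [Fintype B] :
    Set (X → Y → A → B → ℝ) :=
  convexHull ℝ {P | ∃ p ∈ incompleteDist X A, ∃ q ∈ incompleteDist Y B,
    P = fun x y a b => p x a * q y b}

/-- The families `⟨ψ| E_x^a ⊗ F_y^b |ψ⟩` where `ψ` is in the unit ball of `ℂ^d ⊗ ℂ^d`, and the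
positive operators `E_x^a` (resp. `F_y^b`) on `ℂ^d` satisfy `∑ a, E_x^a ≤ Id` for every `x` (resp.
`∑ b, F_y^b ≤ Id` for every `y`). These numbers are automatically real. -/
def incompleteQuantum (X Y A B : Type*) [Fintype A] [Fintype B] :
    Set (X → Y → A → B → ℝ) :=
  {P | ∃ (d : ℕ) (ψ : EuclideanSpace ℂ (Fin d × Fin d))
      (E : X → A → Matrix (Fin d) (Fin d) ℂ) (F : Y → B → Matrix (Fin d) (Fin d) ℂ),
      ‖ψ‖ ≤ 1 ∧
      (∀ x a, (E x a).PosSemidef) ∧ (∀ x, (1 - ∑ a, E x a).PosSemidef) ∧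
      (∀ y b, (F y b).PosSemidef) ∧ (∀ y, (1 - ∑ b, F y b).PosSemidef) ∧
      ∀ x y a b, (P x y a b : ℂ) = inner ℂ ψ (Matrix.toEuclideanLin (E x a ⊗ₖ F y b) ψ)}

/-- The incomplete classical value `ω_inc(M)`; the supremum is taken in `[0, ∞]`. -/
noncomputable def BellFunctional.incValue {X Y A B : Type*}
    [Fintype X] [Fintype Y] [Fintype A] [Fintype B] (M : BellFunctional X Y A B) : ℝ≥0∞ :=
  ⨆ P ∈ incompleteClassical X Y A B, ‖M.eval P‖ₑ

/-- The incomplete entangled value `ω*_inc(M)`; the supremum is taken in `[0, ∞]`. -/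
noncomputable def BellFunctional.incEntangledValue {X Y A B : Type*}
    [Fintype X] [Fintype Y] [Fintype A] [Fintype B] (M : BellFunctional X Y A B) : ℝ≥0∞ :=
  ⨆ P ∈ incompleteQuantum X Y A B, ‖M.eval P‖ₑ

/-! ### The injective norm -/

/-- The injective norm of `z ∈ E ⊗ F`: the supremum of `|⟨z, φ ⊗ ψ⟩|` over `φ`, `ψ` in the closed
unit balls of the dual spaces. -/
noncomputable def injectiveNorm (𝕜 : Type*) [RCLike 𝕜] {E F : Type*}
    [NormedAddCommGroup E] [NormedSpace 𝕜 E] [NormedAddCommGroup F] [NormedSpace 𝕜 F]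
    (z : E ⊗[𝕜] F) : ℝ≥0∞ :=
  ⨆ (φ : StrongDual 𝕜 E) (ψ : StrongDual 𝕜 F) (_ : ‖φ‖ ≤ 1) (_ : ‖ψ‖ ≤ 1),
    ‖TensorProduct.dualDistrib 𝕜 E F (φ.toLinearMap ⊗ₜ[𝕜] ψ.toLinearMap) z‖ₑ

/-- The real Banach space `ℓ_1^X(ℓ_∞^A(ℝ))`, with norm `∑ x, sup_a |r x a|`
(the function space `A → ℝ` carries the supremum norm). -/
abbrev RealL1Linf (X A : Type*) [Fintype X] [Fintype A] := PiLp 1 (fun _ : X => A → ℝ)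

/-- The tensor `∑ M_{x,y}^{a,b} (e_x ⊗ e_a) ⊗ (e_y ⊗ e_b)` over the real spaces. -/
noncomputable def BellFunctional.realTensor {X Y A B : Type*}
    [Fintype X] [Fintype Y] [Fintype A] [Fintype B]
    [DecidableEq X] [DecidableEq Y] [DecidableEq A] [DecidableEq B]
    (M : BellFunctional X Y A B) : RealL1Linf X A ⊗[ℝ] RealL1Linf Y B :=
  ∑ x, ∑ y, ∑ a, ∑ b, M x y a b •
    ((WithLp.toLp 1 (Pi.single x (Pi.single a 1)) : RealL1Linf X A) ⊗ₜ[ℝ]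
      (WithLp.toLp 1 (Pi.single y (Pi.single b 1)) : RealL1Linf Y B))

/-! ### Operator space structures and the minimal norm

Matrices with complex entries carry the operator norm of `ℓ_2`. -/

/-- A sequence of functions on the spaces `M_n(V)`, `n ∈ ℕ`, used to record the matrix norms of an
operator space structure on `V`. -/
abbrev MatrixNorms (V : Type*) := (n : ℕ) → Matrix (Fin n) (Fin n) V → ℝ≥0∞

/-- The completely bounded norm `sup_n ‖T_n : M_n(V) → M_n(W)‖`, where `T_n` applies `T` to every
entry. -/
noncomputable def cbNorm {V W : Type*} [AddCommGroup V] [Module ℂ V] [AddCommGroup W] [Module ℂ W]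
    (ν : MatrixNorms V) (μ : MatrixNorms W) (T : V →ₗ[ℂ] W) : ℝ≥0∞ :=
  ⨆ (n : ℕ) (v : Matrix (Fin n) (Fin n) V) (_ : ν n v ≤ 1), μ n (v.map T)

/-- The operator space `ℂ`: the norm of `M_n(ℂ)` is the operator norm. -/
noncomputable def scalarNorms : MatrixNorms ℂ := fun _ v => ‖v‖ₑ

/-- The operator space `M_d`: the norm of `M_n(M_d) = M_{nd}` is the operator norm. -/
noncomputable def matNorms (d : ℕ) : MatrixNorms (Matrix (Fin d) (Fin d) ℂ) :=
  fun n v => ‖Matrix.comp (Fin n) (Fin n) (Fin d) (Fin d) ℂ v‖ₑ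

/-- The operator space `ℓ_∞^ι(V)`: the norm of `M_n(ℓ_∞^ι(V))` is the supremum over `i` of the norms
in `M_n(V)` of the components. -/
noncomputable def linfNorms (ι : Type*) {V : Type*} (ν : MatrixNorms V) : MatrixNorms (ι → V) :=
  fun n v => ⨆ i, ν n (v.map fun f => f i)

/-- The linear map `T^x : V → M_n`, `v ↦ (x_{ij}(v))_{ij}`, associated to `x ∈ M_n(V^*)`. -/
def dualMatrixMap {V : Type*} [AddCommGroup V] [Module ℂ V] {n : ℕ}
    (x : Matrix (Fin n) (Fin n) (Module.Dual ℂ V)) : V →ₗ[ℂ] Matrix (Fin n) (Fin n) ℂ where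
  toFun v := x.map fun f => f v
  map_add' v w := by ext i j; simp
  map_smul' c v := by ext i j; simp

/-- The dual operator space structure: the norm of `x ∈ M_n(V^*)` is the completely bounded norm of
`T^x : V → M_n`. -/
noncomputable def dualNorms {V : Type*} [AddCommGroup V] [Module ℂ V] (ν : MatrixNorms V) :
    MatrixNorms (Module.Dual ℂ V) :=
  fun n x => cbNorm ν (matNorms n) (dualMatrixMap x)

/-- The canonical pairing `⟨f, g⟩ = ∑ a, f a * g a`, as a map from `ℂ^A` to its dual. -/
def pairing (A : Type*) [Fintype A] : (A → ℂ) →ₗ[ℂ] Module.Dual ℂ (A → ℂ) :=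
  LinearMap.mk₂ ℂ (fun f g => ∑ a, f a * g a)
    (fun f f' g => by simp [add_mul, Finset.sum_add_distrib])
    (fun c f g => by simp [mul_assoc, Finset.mul_sum])
    (fun f g g' => by simp [mul_add, Finset.sum_add_distrib])
    (fun c f g => by simp [mul_left_comm, Finset.mul_sum])

/-- The canonical pairing `⟨f, g⟩ = ∑ x, ∑ a, f x a * g x a`, as a map from `ℂ^{XA}` to its dual. -/
def pairing₂ (X A : Type*) [Fintype X] [Fintype A] :
    (X → A → ℂ) →ₗ[ℂ] Module.Dual ℂ (X → A → ℂ) :=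
  LinearMap.mk₂ ℂ (fun f g => ∑ x, ∑ a, f x a * g x a)
    (fun f f' g => by simp [add_mul, Finset.sum_add_distrib])
    (fun c f g => by simp [mul_assoc, Finset.mul_sum])
    (fun f g g' => by simp [mul_add, Finset.sum_add_distrib])
    (fun c f g => by simp [mul_left_comm, Finset.mul_sum])

/-- The operator space `ℓ_1^A = (ℓ_∞^A)^*`. -/
noncomputable def l1Norms (A : Type*) [Fintype A] : MatrixNorms (A → ℂ) :=
  fun n v => dualNorms (linfNorms A scalarNorms) n (v.map (pairing A))

/-- The operator space `ℓ_1^X(ℓ_∞^A) = (ℓ_∞^X(ℓ_1^A))^*`. -/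
noncomputable def l1LinfNorms (X A : Type*) [Fintype X] [Fintype A] : MatrixNorms (X → A → ℂ) :=
  fun n v => dualNorms (linfNorms X (l1Norms A)) n (v.map (pairing₂ X A))

/-- The map `T ⊗ S : V ⊗ W → M_d ⊗ M_d = M_{d²}`. -/
noncomputable def kroneckerMap {V W : Type*} [AddCommGroup V] [Module ℂ V]
    [AddCommGroup W] [Module ℂ W] {d : ℕ}
    (T : V →ₗ[ℂ] Matrix (Fin d) (Fin d) ℂ) (S : W →ₗ[ℂ] Matrix (Fin d) (Fin d) ℂ) :
    V ⊗[ℂ] W →ₗ[ℂ] Matrix (Fin d × Fin d) (Fin d × Fin d) ℂ :=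
  TensorProduct.lift ((Matrix.kroneckerBilinear (R := ℂ) (α := ℂ)).compl₁₂ T S)

/-- The minimal norm of `z ∈ V ⊗ W`: the supremum of `‖(T ⊗ S)(z)‖` over all `d` and all complete
contractions `T : V → M_d`, `S : W → M_d`. -/
noncomputable def minNorm {V W : Type*} [AddCommGroup V] [Module ℂ V]
    [AddCommGroup W] [Module ℂ W] (ν : MatrixNorms V) (μ : MatrixNorms W) (z : V ⊗[ℂ] W) : ℝ≥0∞ :=
  ⨆ (d : ℕ) (T : V →ₗ[ℂ] Matrix (Fin d) (Fin d) ℂ) (S : W →ₗ[ℂ] Matrix (Fin d) (Fin d) ℂ)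
    (_ : cbNorm ν (matNorms d) T ≤ 1) (_ : cbNorm μ (matNorms d) S ≤ 1), ‖kroneckerMap T S z‖ₑ

/-- The tensor `∑ M_{x,y}^{a,b} (e_x ⊗ e_a) ⊗ (e_y ⊗ e_b)` over the complex spaces. -/
noncomputable def BellFunctional.complexTensor {X Y A B : Type*}
    [Fintype X] [Fintype Y] [Fintype A] [Fintype B]
    [DecidableEq X] [DecidableEq Y] [DecidableEq A] [DecidableEq B]
    (M : BellFunctional X Y A B) : (X → A → ℂ) ⊗[ℂ] (Y → B → ℂ) :=
  ∑ x, ∑ y, ∑ a, ∑ b, (M x y a b : ℂ) •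
    ((Pi.single x (Pi.single a 1) : X → A → ℂ) ⊗ₜ[ℂ] (Pi.single y (Pi.single b 1) : Y → B → ℂ))

/-!
Both lines compare a supremum over positive objects (incomplete distributions, incomplete
measurements) with a supremum over the unit ball of the dual, resp. over complete contractions. The
lower bounds say that the positive objects lie in these unit balls; the upper bounds say that an
element of the unit ball is a difference of two positive ones, which costs a factor `2` on each
side.

In the real case the dual unit ball of `ℓ_1^X(ℓ_∞^A)` consists of the `φ` with `∑ a, |φ x a| ≤ 1`
for all `x` (`norm_dual_realL1Linf_le_one_iff`), and one splits `φ` into its positive and negative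
parts.

In the complex case, unfolding the dualities shows that `T` is a complete contraction on
`ℓ_1^X(ℓ_∞^A)` if and only if for each `x` the matrices `T_a = T (e_x ⊗ e_a)` satisfy
`‖∑ a, w_a ⊗ T_a‖ ≤ 1` for all contractions `w_a` of all sizes (`cbNorm_l1LinfNorms_le_one_iff`).
Incomplete measurements have this property (`norm_sum_kronecker_le_one`), which gives the lower
bound.

For the upper bound, `T` is replaced by its Hermitian dilation `[[0, T], [T⋆, 0]]`, which has the
same property. A Hermitian family `T_a` with this property is dominated, `-P_a ≤ T_a ≤ P_a`, by a
family with `∑ a, P_a ≤ r`, for every `r > 1` (`exists_dominating_family`). This is a form of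
Wittstock's decomposition theorem. It is proved by convex duality: otherwise the Hahn-Banach
theorem gives a positive `Y ≠ 0` whose pairing with all the sums `∑ a, P_a` is at least `r * tr Y`.
If `Y = B⋆ B` with `B` invertible, as may be assumed after adding a small multiple of the identity,
the choice `P_a = B⁻¹ |B T_a B⋆| B⁻¹⋆` yields the pairing `∑ a, tr (W_a B T_a B⋆)`, with `W_a` the
sign of `B T_a B⋆`; this is the quadratic form of `∑ a, W_aᵀ ⊗ T_a` at the vectorization of `B⋆`,
and so it is at most `tr Y`, a contradiction.
The dilations are therefore `r` times a difference of two incomplete measurements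
(`exists_subPOVM_sub`). Finally, as the coefficients of the Bell functional are real, the matrix
coefficient `⟨u, (T ⊗ S)(M) v⟩` has real part half the quadratic form at `u ⊕ v` of the Bell
operator of the dilations, which splits into four terms (`BellFunctional.norm_operator_le`).
-/

/-! ### The operator norm of matrices through sesquilinear forms -/

theorem re_star_dotProduct_self {n : Type*} [Fintype n] (u : n → ℂ) :
    (star u ⬝ᵥ u).re = ‖WithLp.toLp 2 u‖ ^ 2 := by
  have h := @inner_self_eq_norm_sq ℂ _ _ _ _ (WithLp.toLp 2 u : EuclideanSpace ℂ n)
  rw [← h, EuclideanSpace.inner_eq_star_dotProduct, dotProduct_comm]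
  rfl

theorem re_star_dotProduct_self_nonneg {n : Type*} [Fintype n] (u : n → ℂ) :
    0 ≤ (star u ⬝ᵥ u).re := by
  rw [re_star_dotProduct_self]; positivity

/-- By homogeneity, an operator norm bound is equivalent to an inequality between a sesquilinear
form and the squared norms of its arguments; such inequalities can be added up. -/
theorem l2_opNorm_le_iff_form {n : Type*} [Fintype n] [DecidableEq n] (G : Matrix n n ℂ) {C : ℝ}
    (hC : 0 ≤ C) :
    ‖G‖ ≤ C ↔ ∀ u v : n → ℂ,
      2 * (star u ⬝ᵥ G.mulVec v).re ≤ C * ((star u ⬝ᵥ u).re + (star v ⬝ᵥ v).re) := by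
  have key (u v : n → ℂ) : (star u ⬝ᵥ G.mulVec v) =
      inner ℂ (WithLp.toLp 2 u) (Matrix.toEuclideanCLM (n := n) (𝕜 := ℂ) G (WithLp.toLp 2 v)) := by
    rw [EuclideanSpace.inner_eq_star_dotProduct, dotProduct_comm]
    rfl
  constructor
  · intro h u v
    rw [key, re_star_dotProduct_self, re_star_dotProduct_self]
    have h1 := re_inner_le_norm (𝕜 := ℂ) (WithLp.toLp 2 u)
      (Matrix.toEuclideanCLM (n := n) (𝕜 := ℂ) G (WithLp.toLp 2 v))
    have h2 : ‖Matrix.toEuclideanCLM (n := n) (𝕜 := ℂ) G (WithLp.toLp 2 v)‖ ≤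
        C * ‖WithLp.toLp 2 v‖ :=
      (ContinuousLinearMap.le_opNorm _ _).trans
        (mul_le_mul_of_nonneg_right (by rwa [Matrix.l2_opNorm_toEuclideanCLM]) (norm_nonneg _))
    have h3 := mul_le_mul_of_nonneg_left h2 (norm_nonneg (WithLp.toLp 2 u))
    have h4 := mul_nonneg hC (sq_nonneg (‖WithLp.toLp 2 u‖ - ‖WithLp.toLp 2 v‖))
    simp only [RCLike.re_to_complex] at h1
    linarith
  · intro h
    rw [Matrix.cstar_norm_def]
    refine ContinuousLinearMap.opNorm_le_of_re_inner_le hC fun x y hx hy ↦ ?_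
    have h1 := h (WithLp.ofLp y) (WithLp.ofLp x)
    rw [key, re_star_dotProduct_self, re_star_dotProduct_self] at h1
    simp only [WithLp.toLp_ofLp, hx, hy] at h1
    rw [← inner_conj_symm]
    simp only [RCLike.conj_re, RCLike.re_to_complex] at h1 ⊢
    linarith

theorem l2_opNorm_submatrix_equiv_le {m n : Type*} [Fintype m] [DecidableEq m] [Fintype n]
    [DecidableEq n] (G : Matrix n n ℂ) (e : m ≃ n) : ‖G.submatrix e e‖ ≤ ‖G‖ := by
  rw [l2_opNorm_le_iff_form _ (norm_nonneg _)]
  intro u v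
  have h := (l2_opNorm_le_iff_form G (norm_nonneg _)).1 le_rfl (u ∘ e.symm) (v ∘ e.symm)
  have hs (w : m → ℂ) : star (w ∘ e.symm) = star w ∘ e.symm := rfl
  rw [Matrix.submatrix_mulVec_equiv, ← comp_equiv_symm_dotProduct]
  simpa only [hs, comp_equiv_dotProduct_comp_equiv] using h

theorem l2_opNorm_submatrix_equiv {m n : Type*} [Fintype m] [DecidableEq m] [Fintype n]
    [DecidableEq n] (G : Matrix n n ℂ) (e : m ≃ n) : ‖G.submatrix e e‖ = ‖G‖ := by
  refine le_antisymm (l2_opNorm_submatrix_equiv_le G e) ?_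
  simpa using l2_opNorm_submatrix_equiv_le (G.submatrix e e) e.symm

theorem dotProduct_kronecker_one_mulVec {m n : Type*} [Fintype m] [Fintype n] [DecidableEq n]
    (w : Matrix m m ℂ) (u v : m × n → ℂ) :
    star u ⬝ᵥ (w ⊗ₖ (1 : Matrix n n ℂ)).mulVec v =
      ∑ c, star (fun i ↦ u (i, c)) ⬝ᵥ w.mulVec fun i ↦ v (i, c) := by
  simp only [dotProduct, Matrix.mulVec, Fintype.sum_prod_type, Matrix.kroneckerMap_apply,
    Matrix.one_apply, Pi.star_apply]
  rw [Finset.sum_comm]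
  simp

theorem dotProduct_self_prod {m n : Type*} [Fintype m] [Fintype n] (u : m × n → ℂ) :
    star u ⬝ᵥ u = ∑ c, star (fun i ↦ u (i, c)) ⬝ᵥ (fun i ↦ u (i, c)) := by
  simp only [dotProduct, Fintype.sum_prod_type, Pi.star_apply]
  rw [Finset.sum_comm]

theorem form_conjTranspose_mul_mul {m n : Type*} [Fintype m] [Fintype n]
    (Z : Matrix m n ℂ) (X : Matrix m m ℂ) (u v : n → ℂ) :
    star u ⬝ᵥ (Z.conjTranspose * X * Z).mulVec v =
      star (Z.mulVec u) ⬝ᵥ X.mulVec (Z.mulVec v) := by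
  rw [Matrix.star_mulVec, ← Matrix.dotProduct_mulVec, Matrix.mulVec_mulVec, Matrix.mulVec_mulVec,
    Matrix.mul_assoc]

/-- The form of `w ⊗ E`, with `w` a contraction and `E` positive, is dominated by that of
`1 ⊗ E`: writing `E = Z⋆ Z`, it is the form of `w ⊗ 1` in the vectors `(1 ⊗ Z) u`, `(1 ⊗ Z) v`. -/
theorem form_kronecker_posSemidef_le {m n : Type*} [Fintype m] [DecidableEq m] [Fintype n]
    [DecidableEq n] {w : Matrix m m ℂ} (hw : ‖w‖ ≤ 1) {E : Matrix n n ℂ} (hE : E.PosSemidef)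
    (u v : m × n → ℂ) :
    2 * (star u ⬝ᵥ (w ⊗ₖ E).mulVec v).re ≤
      (star u ⬝ᵥ ((1 : Matrix m m ℂ) ⊗ₖ E).mulVec u).re +
        (star v ⬝ᵥ ((1 : Matrix m m ℂ) ⊗ₖ E).mulVec v).re := by
  open scoped MatrixOrder in
  obtain ⟨Z, rfl⟩ := CStarAlgebra.nonneg_iff_eq_star_mul_self.mp hE.nonneg
  have hfac (x : Matrix m m ℂ) : x ⊗ₖ (star Z * Z) =
      ((1 : Matrix m m ℂ) ⊗ₖ Z).conjTranspose * (x ⊗ₖ (1 : Matrix n n ℂ)) *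
        ((1 : Matrix m m ℂ) ⊗ₖ Z) := by
    rw [Matrix.conjTranspose_kronecker, ← Matrix.mul_kronecker_mul, ← Matrix.mul_kronecker_mul]
    simp [Matrix.star_eq_conjTranspose]
  simp only [hfac, form_conjTranspose_mul_mul]
  rw [Matrix.one_kronecker_one, Matrix.one_mulVec, Matrix.one_mulVec,
    dotProduct_kronecker_one_mulVec, dotProduct_self_prod, dotProduct_self_prod]
  simp only [Complex.re_sum, Finset.mul_sum]
  rw [← Finset.sum_add_distrib]
  refine Finset.sum_le_sum fun c _ ↦ ?_
  simpa using (l2_opNorm_le_iff_form w zero_le_one).1 hw _ _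

/-- The map `f ↦ ∑ a, f a • E a` is a complete contraction on `ℓ_∞^A` as soon as the `E a` are
positive and `∑ a, E a ≤ 1`. -/
theorem norm_sum_kronecker_le_one {A m n : Type*} [Fintype A] [Fintype m] [DecidableEq m]
    [Fintype n] [DecidableEq n] {w : A → Matrix m m ℂ} (hw : ∀ a, ‖w a‖ ≤ 1)
    {E : A → Matrix n n ℂ} (hE : ∀ a, (E a).PosSemidef) (hE1 : (1 - ∑ a, E a).PosSemidef) :
    ‖∑ a, w a ⊗ₖ E a‖ ≤ 1 := by
  rw [l2_opNorm_le_iff_form _ zero_le_one]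
  intro u v
  have hsum (u : m × n → ℂ) :
      ∑ a, (star u ⬝ᵥ ((1 : Matrix m m ℂ) ⊗ₖ E a).mulVec u).re ≤ (star u ⬝ᵥ u).re := by
    have h := (Matrix.PosSemidef.one (n := m) (R := ℂ)).kronecker hE1
    have h' := (Complex.le_def.1 (h.dotProduct_mulVec_nonneg u)).1
    have hlin : (1 : Matrix m m ℂ) ⊗ₖ (1 - ∑ a, E a) = 1 - ∑ a, (1 : Matrix m m ℂ) ⊗ₖ E a := by
      ext ⟨i, k⟩ ⟨j, l⟩
      simp [Matrix.sum_apply, mul_sub, Finset.mul_sum, Matrix.one_apply, ← ite_and, and_comm]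
    rw [hlin, Matrix.sub_mulVec, Matrix.one_mulVec, Matrix.sum_mulVec, dotProduct_sub,
      dotProduct_sum] at h'
    simp only [Complex.zero_re, Complex.sub_re, Complex.re_sum] at h'
    linarith
  rw [Matrix.sum_mulVec, dotProduct_sum, Complex.re_sum, Finset.mul_sum, one_mul]
  refine (Finset.sum_le_sum fun a _ ↦ form_kronecker_posSemidef_le (hw a) (hE a) u v).trans ?_
  rw [Finset.sum_add_distrib]
  exact add_le_add (hsum u) (hsum v)

/-! ### Complete contractions on `ℓ_1^X(ℓ_∞^A)` -/

theorem enorm_le_one_iff_norm {E : Type*} [SeminormedAddCommGroup E] (x : E) :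
    ‖x‖ₑ ≤ 1 ↔ ‖x‖ ≤ 1 := by
  rw [← ofReal_norm, ENNReal.ofReal_le_one]

theorem cbNorm_le_one_iff {V W : Type*} [AddCommGroup V] [Module ℂ V] [AddCommGroup W] [Module ℂ W]
    (ν : MatrixNorms V) (μ : MatrixNorms W) (T : V →ₗ[ℂ] W) :
    cbNorm ν μ T ≤ 1 ↔ ∀ n (v : Matrix (Fin n) (Fin n) V), ν n v ≤ 1 → μ n (v.map T) ≤ 1 := by
  simp only [cbNorm, iSup_le_iff]

/-- By definition, the norm of `M_m(ℓ_1^A)` is tested against families of contractions of all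
sizes. -/
theorem l1Norms_le_one_iff {A : Type*} [Fintype A] {m : ℕ} (g : Matrix (Fin m) (Fin m) (A → ℂ)) :
    l1Norms A m g ≤ 1 ↔ ∀ n (w : A → Matrix (Fin n) (Fin n) ℂ), (∀ a, ‖w a‖ ≤ 1) →
      ‖∑ a, w a ⊗ₖ g.map (· a)‖ ≤ 1 := by
  have key (n : ℕ) (v : Matrix (Fin n) (Fin n) (A → ℂ)) :
      Matrix.comp (Fin n) (Fin n) (Fin m) (Fin m) ℂ (v.map (dualMatrixMap (g.map (pairing A)))) =
        ∑ a, v.map (· a) ⊗ₖ g.map (· a) := by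
    ext ⟨i, k⟩ ⟨j, l⟩
    simp [dualMatrixMap, pairing, Matrix.sum_apply, mul_comm]
  simp only [l1Norms, dualNorms, cbNorm_le_one_iff, matNorms, linfNorms, scalarNorms, iSup_le_iff,
    key, enorm_le_one_iff_norm]
  refine forall_congr' fun n ↦ ⟨fun h w hw ↦ ?_, fun h v hv ↦ h (fun a ↦ v.map (· a)) hv⟩
  exact h (Matrix.of fun i j a ↦ w a i j) hw

theorem l1LinfNorms_le_one_iff {X A : Type*} [Fintype X] [Fintype A] {n : ℕ}
    (v : Matrix (Fin n) (Fin n) (X → A → ℂ)) :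
    l1LinfNorms X A n v ≤ 1 ↔ ∀ m (g : Matrix (Fin m) (Fin m) (X → A → ℂ)),
      (∀ x, l1Norms A m (g.map (· x)) ≤ 1) →
      ‖∑ x, ∑ a, v.map (· x a) ⊗ₖ g.map (· x a)‖ ≤ 1 := by
  have key (m : ℕ) (g : Matrix (Fin m) (Fin m) (X → A → ℂ)) :
      Matrix.comp (Fin m) (Fin m) (Fin n) (Fin n) ℂ
          (g.map (dualMatrixMap (v.map (pairing₂ X A)))) =
        (∑ x, ∑ a, v.map (· x a) ⊗ₖ g.map (· x a)).submatrix
          (Equiv.prodComm _ _) (Equiv.prodComm _ _) := by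
    ext ⟨i, k⟩ ⟨j, l⟩
    simp [dualMatrixMap, pairing₂, Matrix.sum_apply]
  simp only [l1LinfNorms, dualNorms, cbNorm_le_one_iff, matNorms, linfNorms, iSup_le_iff,
    key, enorm_le_one_iff_norm, l2_opNorm_submatrix_equiv]

/-- A map `T` on `ℓ_1^X(ℓ_∞^A)` is completely contractive if and only if, for each `x`, the
map `f ↦ ∑ a, f a • T (e_x ⊗ e_a)` on `ℓ_∞^A` is completely contractive: up to the flip of
`M_n ⊗ M_d`, the norm of `M_n(ℓ_1^X(ℓ_∞^A))` is a supremum over all such families. -/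
theorem cbNorm_l1LinfNorms_le_one_iff {X A : Type*} [Fintype X] [Fintype A] [DecidableEq X]
    [DecidableEq A] {d : ℕ} (T : (X → A → ℂ) →ₗ[ℂ] Matrix (Fin d) (Fin d) ℂ) :
    cbNorm (l1LinfNorms X A) (matNorms d) T ≤ 1 ↔
      ∀ x n (w : A → Matrix (Fin n) (Fin n) ℂ), (∀ a, ‖w a‖ ≤ 1) →
        ‖∑ a, w a ⊗ₖ T (Pi.single x (Pi.single a 1))‖ ≤ 1 := by
  have hT (f : X → A → ℂ) : T f = ∑ x, ∑ a, f x a • T (Pi.single x (Pi.single a 1)) := by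
    conv_lhs => rw [show f = ∑ x, ∑ a, f x a • (Pi.single x (Pi.single a 1) : X → A → ℂ) by
      ext x a; simp [Finset.sum_apply, Pi.single_apply, ite_apply]]
    simp
  have key (n : ℕ) (v : Matrix (Fin n) (Fin n) (X → A → ℂ)) :
      Matrix.comp (Fin n) (Fin n) (Fin d) (Fin d) ℂ (v.map T) =
        ∑ x, ∑ a, v.map (· x a) ⊗ₖ T (Pi.single x (Pi.single a 1)) := by
    ext ⟨i, k⟩ ⟨j, l⟩
    simp [hT (v i j), Matrix.sum_apply]
  simp only [cbNorm_le_one_iff, matNorms, key, enorm_le_one_iff_norm]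
  constructor
  · intro h x n w hw
    -- the family `w` placed at the coordinate `x` lies in the unit ball of `M_n(ℓ_1^X(ℓ_∞^A))`
    let v : Matrix (Fin n) (Fin n) (X → A → ℂ) :=
      Matrix.of fun i j x' a ↦ if x' = x then w a i j else 0
    have hv (a : A) : v.map (· x a) = w a := by ext i j; simp [v]
    have hv' (x' : X) (hx : x' ≠ x) (a : A) : v.map (· x' a) = 0 := by ext i j; simp [v, hx]
    have hsum {m : ℕ} (F : X → A → Matrix (Fin m) (Fin m) ℂ) :
        ∑ x', ∑ a, v.map (· x' a) ⊗ₖ F x' a = ∑ a, w a ⊗ₖ F x a := by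
      rw [Finset.sum_eq_single x (fun x' _ hx ↦ by simp [hv' x' hx]) (by simp)]
      simp [hv]
    rw [← hsum fun x a ↦ T (Pi.single x (Pi.single a 1))]
    refine h n v ((l1LinfNorms_le_one_iff v).2 fun m g hg ↦ ?_)
    rw [hsum]
    exact (l1Norms_le_one_iff _).1 (hg x) n w hw
  · intro h n v hv
    -- the coefficients of `T` form an element `g` of the unit ball of `M_d(ℓ_∞^X(ℓ_1^A))`
    let g : Matrix (Fin d) (Fin d) (X → A → ℂ) :=
      Matrix.of fun k l x a ↦ T (Pi.single x (Pi.single a 1)) k l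
    exact (l1LinfNorms_le_one_iff v).1 hv d g fun x ↦ (l1Norms_le_one_iff _).2 (h x)

/-! ### Domination of Hermitian complete contractions on `ℓ_∞^A` -/

/-- A Hermitian matrix `N` has a Hermitian unitary sign `W`: `W * N` is the absolute value of `N`,
and dominates `N` and `-N`. -/
theorem Matrix.IsHermitian.exists_sign {n : Type*} [Fintype n] [DecidableEq n] {N : Matrix n n ℂ}
    (hN : N.IsHermitian) : ∃ W : Matrix n n ℂ, W.IsHermitian ∧ W * W = 1 ∧
      (W * N - N).PosSemidef ∧ (W * N + N).PosSemidef := by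
  set U : Matrix n n ℂ := (hN.eigenvectorUnitary : Matrix n n ℂ)
  have hUU : U.conjTranspose * U = 1 := Unitary.coe_star_mul_self hN.eigenvectorUnitary
  have hUU' : U * U.conjTranspose = 1 := Unitary.coe_mul_star_self hN.eigenvectorUnitary
  set D : n → ℝ := hN.eigenvalues
  -- the value `1` at the eigenvalue `0` makes the sign unitary
  let s : n → ℝ := fun i ↦ if 0 ≤ D i then 1 else -1
  let conj (f : n → ℝ) : Matrix n n ℂ :=
    U * Matrix.diagonal (fun i ↦ (f i : ℂ)) * U.conjTranspose
  have hmul (f g : n → ℝ) : conj f * conj g = conj (fun i ↦ f i * g i) := by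
    simp only [conj]
    calc _ = U * Matrix.diagonal (fun i ↦ (f i : ℂ)) * (U.conjTranspose * U) *
          Matrix.diagonal (fun i ↦ (g i : ℂ)) * U.conjTranspose := by noncomm_ring
      _ = _ := by
        rw [hUU, mul_one, mul_assoc U, Matrix.diagonal_mul_diagonal]; simp
  have hNc : N = conj D := by
    conv_lhs => rw [hN.spectral_theorem, Unitary.conjStarAlgAut_apply]
    rfl
  have hpsd (f : n → ℝ) (hf : ∀ i, 0 ≤ f i) : (conj f).PosSemidef :=
    (Matrix.PosSemidef.diagonal fun i ↦ by simpa using hf i).mul_mul_conjTranspose_same U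
  have hadd (f g : n → ℝ) : conj f + conj g = conj (fun i ↦ f i + g i) := by
    simp only [conj]
    rw [← add_mul, ← mul_add, Matrix.diagonal_add]; simp
  have hsub (f g : n → ℝ) : conj f - conj g = conj (fun i ↦ f i - g i) := by
    simp only [conj]
    rw [← sub_mul, ← mul_sub, Matrix.diagonal_sub]; simp
  refine ⟨conj s, ?_, ?_, ?_, ?_⟩
  · simp only [conj]
    refine Matrix.isHermitian_mul_mul_conjTranspose _
      (Matrix.isHermitian_diagonal_of_self_adjoint _ ?_)
    ext i; simp
  · rw [hmul]
    have : (fun i ↦ s i * s i) = fun _ ↦ 1 := by ext i; simp only [s]; split_ifs <;> norm_num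
    simp [this, conj, hUU']
  · rw [hNc, hmul, hsub]
    refine hpsd _ fun i ↦ ?_
    simp only [s]; split_ifs <;> linarith
  · rw [hNc, hmul, hadd]
    refine hpsd _ fun i ↦ ?_
    simp only [s]; split_ifs <;> linarith

theorem Matrix.PosSemidef.re_trace_nonneg {n : Type*} [Fintype n] {Y : Matrix n n ℂ}
    (hY : Y.PosSemidef) : 0 ≤ Y.trace.re := (Complex.le_def.1 hY.trace_nonneg).1

theorem Matrix.IsHermitian.norm_transpose_le_one {n : Type*} [Fintype n] [DecidableEq n]
    {W : Matrix n n ℂ} (hW : W.IsHermitian) (h1 : W * W = 1) : ‖W.transpose‖ ≤ 1 := by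
  have h : ‖W.transpose‖ * ‖W.transpose‖ ≤ 1 := by
    rw [← Matrix.l2_opNorm_conjTranspose_mul_self, hW.transpose.eq, ← Matrix.transpose_mul, h1,
      Matrix.transpose_one, ← Matrix.diagonal_one, Matrix.l2_opNorm_diagonal]
    exact (pi_norm_le_iff_of_nonneg zero_le_one).2 fun i ↦ by simp
  nlinarith [norm_nonneg W.transpose]

/-- A positive functional on matrices, restricted to Hermitian matrices, is given by a positive
density. -/
theorem exists_density {n : Type*} [Fintype n] [DecidableEq n] (g : Matrix n n ℂ →ₗ[ℂ] ℂ)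
    (hg : ∀ H : Matrix n n ℂ, H.PosSemidef → 0 ≤ (g H).re) :
    ∃ Y : Matrix n n ℂ, Y.PosSemidef ∧
      ∀ H : Matrix n n ℂ, H.IsHermitian → (g H).re = (Y * H).trace.re := by
  let Y₀ : Matrix n n ℂ := Matrix.of fun j i ↦ g (Matrix.single i j 1)
  have hg₀ (H : Matrix n n ℂ) : g H = (Y₀ * H).trace := by
    conv_lhs => rw [Matrix.matrix_eq_sum_single H]
    have (i j : n) : Matrix.single i j (H i j) = H i j • Matrix.single i j (1 : ℂ) := by simp
    simp only [this, map_sum, map_smul, smul_eq_mul, Matrix.trace, Matrix.diag, Matrix.mul_apply,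
      Y₀, Matrix.of_apply]
    rw [Finset.sum_comm]
    simp only [mul_comm]
  let Y : Matrix n n ℂ := (1 / 2 : ℂ) • (Y₀ + Y₀.conjTranspose)
  have hY : Y.IsHermitian := by
    simp only [Y, Matrix.IsHermitian, Matrix.conjTranspose_smul, Matrix.conjTranspose_add,
      Matrix.conjTranspose_conjTranspose, add_comm]
    simp
  have hYg (H : Matrix n n ℂ) (hH : H.IsHermitian) : (g H).re = (Y * H).trace.re := by
    have h1 : (Y₀.conjTranspose * H).trace = star (Y₀ * H).trace := by
      rw [← Matrix.trace_conjTranspose, Matrix.conjTranspose_mul, hH.eq, Matrix.trace_mul_comm]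
    have h2 : (Y * H).trace = (1 / 2 : ℂ) * ((Y₀ * H).trace + star (Y₀ * H).trace) := by
      simp only [Y, Matrix.smul_mul, Matrix.trace_smul, Matrix.add_mul, Matrix.trace_add, h1,
        smul_eq_mul]
    rw [h2, hg₀]
    simp
    ring
  refine ⟨Y, .of_dotProduct_mulVec_nonneg hY fun x ↦ ?_, hYg⟩
  rw [Complex.le_def]
  refine ⟨?_, (hY.im_star_dotProduct_mulVec_self x).symm⟩
  have hx := Matrix.posSemidef_vecMulVec_self_star x
  have := hg _ hx
  rwa [hYg _ hx.isHermitian, Matrix.mul_vecMulVec, Matrix.trace_vecMulVec, dotProduct_comm] at this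

/-- The key estimate of the duality argument. For a Hermitian family `T` inducing a complete
contraction on `ℓ_∞^A` and an invertible `B`, the families `P a ≥ ± T a` obtained by pulling back
the absolute values of `B (T a) B⋆` pair with the density `B⋆ B` to at most its trace. -/
theorem exists_dominating_trace_le {A n : Type*} [Fintype A] [Fintype n] [DecidableEq n]
    {T : A → Matrix n n ℂ} (hT : ∀ a, (T a).IsHermitian)
    (hcb : ∀ W : A → Matrix n n ℂ, (∀ a, ‖W a‖ ≤ 1) → ‖∑ a, W a ⊗ₖ T a‖ ≤ 1)
    {B : Matrix n n ℂ} (hB : IsUnit B) :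
    ∃ P : A → Matrix n n ℂ, (∀ a, (P a - T a).PosSemidef) ∧ (∀ a, (P a + T a).PosSemidef) ∧
      (B.conjTranspose * B * ∑ a, P a).trace.re ≤ (B.conjTranspose * B).trace.re := by
  have hdet : IsUnit B.det := (Matrix.isUnit_iff_isUnit_det B).1 hB
  have hBl : B⁻¹ * B = 1 := Matrix.nonsing_inv_mul _ hdet
  have hBr : B * B⁻¹ = 1 := Matrix.mul_nonsing_inv _ hdet
  have hBl' : B.conjTranspose * B⁻¹.conjTranspose = 1 := by
    rw [← Matrix.conjTranspose_mul, hBl, Matrix.conjTranspose_one]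
  have hN (a : A) : (B * T a * B.conjTranspose).IsHermitian :=
    Matrix.isHermitian_mul_mul_conjTranspose _ (hT a)
  choose W hW hWW hsub hadd using fun a ↦ (hN a).exists_sign
  have hTa (a : A) : B⁻¹ * (B * T a * B.conjTranspose) * B⁻¹.conjTranspose = T a := by
    calc _ = B⁻¹ * B * T a * (B.conjTranspose * B⁻¹.conjTranspose) := by noncomm_ring
      _ = T a := by rw [hBl, hBl', one_mul, mul_one]
  refine ⟨fun a ↦ B⁻¹ * (W a * (B * T a * B.conjTranspose)) * B⁻¹.conjTranspose, fun a ↦ ?_,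
    fun a ↦ ?_, ?_⟩
  · have := (hsub a).mul_mul_conjTranspose_same B⁻¹
    rwa [mul_sub, sub_mul, hTa] at this
  · have := (hadd a).mul_mul_conjTranspose_same B⁻¹
    rwa [mul_add, add_mul, hTa] at this
  · have htr (a : A) : (B.conjTranspose * B *
        (B⁻¹ * (W a * (B * T a * B.conjTranspose)) * B⁻¹.conjTranspose)).trace =
        star (Matrix.vec B.conjTranspose) ⬝ᵥ
          ((W a).transpose ⊗ₖ T a).mulVec (Matrix.vec B.conjTranspose) := by
      rw [Matrix.kronecker_mulVec_vec, Matrix.star_vec_dotProduct_vec, Matrix.transpose_transpose,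
        Matrix.conjTranspose_conjTranspose]
      calc _ = (B.conjTranspose * (B * B⁻¹ * (W a * (B * T a * B.conjTranspose)) *
              B⁻¹.conjTranspose)).trace := by congr 1; noncomm_ring
        _ = (W a * (B * T a * B.conjTranspose) *
              (B⁻¹.conjTranspose * B.conjTranspose)).trace := by
            rw [Matrix.trace_mul_comm, hBr, one_mul, mul_assoc]
        _ = (W a * (B * T a * B.conjTranspose)).trace := by
            rw [← Matrix.conjTranspose_mul, hBr, Matrix.conjTranspose_one, mul_one]
        _ = _ := by rw [Matrix.trace_mul_comm]; congr 1; noncomm_ring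
    have h := (l2_opNorm_le_iff_form _ zero_le_one).1
      (hcb (fun a ↦ (W a).transpose) fun a ↦ (hW a).norm_transpose_le_one (hWW a))
      (Matrix.vec B.conjTranspose) (Matrix.vec B.conjTranspose)
    rw [Matrix.sum_mulVec, dotProduct_sum, Matrix.star_vec_dotProduct_vec,
      Matrix.conjTranspose_conjTranspose, Matrix.trace_mul_comm B] at h
    rw [Finset.mul_sum, Matrix.trace_sum, Finset.sum_congr rfl fun a _ ↦ htr a]
    linarith

theorem Matrix.IsHermitian.posSemidef_smul_one_sub {n : Type*} [Fintype n] [DecidableEq n]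
    {K : Matrix n n ℂ} (hK : K.IsHermitian) {r : ℝ} (hr : ‖K‖ ≤ r) :
    (r • (1 : Matrix n n ℂ) - K).PosSemidef := by
  have hH : (r • (1 : Matrix n n ℂ) - K).IsHermitian := by
    refine Matrix.IsHermitian.sub ?_ hK
    simp [Matrix.IsHermitian, Matrix.conjTranspose_smul]
  refine .of_dotProduct_mulVec_nonneg hH fun x ↦ ?_
  rw [Complex.le_def]
  refine ⟨?_, (hH.im_star_dotProduct_mulVec_self x).symm⟩
  have h := (l2_opNorm_le_iff_form K ((norm_nonneg K).trans hr)).1 hr x x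
  simp only [Matrix.sub_mulVec, Matrix.smul_mulVec, Matrix.one_mulVec, dotProduct_sub,
    dotProduct_smul, Complex.sub_re, Complex.real_smul, Complex.re_ofReal_mul, Complex.zero_re]
  linarith

theorem Matrix.PosSemidef.of_sub_add {n : Type*} {P T : Matrix n n ℂ} (h1 : (P - T).PosSemidef)
    (h2 : (P + T).PosSemidef) : P.PosSemidef := by
  have h := (h1.add h2).smul (show (0 : ℝ) ≤ 1 / 2 by norm_num)
  have he : (1 / 2 : ℝ) • ((P - T) + (P + T)) = P := by module
  rwa [he] at h

/-- Self-adjoint Wittstock decomposition on `ℓ_∞^A`, up to a factor `r > 1`: a Hermitian family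
inducing a complete contraction is dominated, up to sign, by a positive family of sum at most `r`.
If there were none, the ball of radius `r` could be separated from the sums of all dominating
families, and the density of the separating functional would contradict
`exists_dominating_trace_le`. -/
theorem exists_dominating_family {A n : Type*} [Fintype A] [Fintype n] [DecidableEq n]
    {T : A → Matrix n n ℂ} (hT : ∀ a, (T a).IsHermitian)
    (hcb : ∀ W : A → Matrix n n ℂ, (∀ a, ‖W a‖ ≤ 1) → ‖∑ a, W a ⊗ₖ T a‖ ≤ 1)
    {r : ℝ} (hr : 1 < r) :
    ∃ P : A → Matrix n n ℂ, (∀ a, (P a - T a).PosSemidef) ∧ (∀ a, (P a + T a).PosSemidef) ∧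
      (r • (1 : Matrix n n ℂ) - ∑ a, P a).PosSemidef := by
  by_contra hne
  push Not at hne
  let t : Set (Matrix n n ℂ) := {X | ∃ (P : A → Matrix n n ℂ) (H : Matrix n n ℂ),
    (∀ a, (P a - T a).PosSemidef) ∧ (∀ a, (P a + T a).PosSemidef) ∧ H.PosSemidef ∧
      X = ∑ a, P a + H}
  have ht : Convex ℝ t := by
    rintro _ ⟨P, H, h1, h2, h3, rfl⟩ _ ⟨P', H', h1', h2', h3', rfl⟩ p q hp hq hpq
    obtain rfl : q = 1 - p := by linarith
    refine ⟨fun a ↦ p • P a + (1 - p) • P' a, p • H + (1 - p) • H', fun a ↦ ?_, fun a ↦ ?_,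
      (h3.smul hp).add (h3'.smul hq), ?_⟩
    · convert! ((h1 a).smul hp).add ((h1' a).smul hq) using 1
      module
    · convert! ((h2 a).smul hp).add ((h2' a).smul hq) using 1
      module
    · rw [Finset.sum_add_distrib, ← Finset.smul_sum, ← Finset.smul_sum]
      module
  have hdisj : Disjoint (Metric.ball (0 : Matrix n n ℂ) r) t := by
    rw [Set.disjoint_left]
    rintro _ hX ⟨P, H, h1, h2, h3, rfl⟩
    have hP := Matrix.posSemidef_sum Finset.univ fun a _ ↦ (h1 a).of_sub_add (h2 a)
    refine hne P h1 h2 ?_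
    have h := ((hP.add h3).isHermitian.posSemidef_smul_one_sub
      (mem_ball_zero_iff.1 hX).le).add h3
    convert! h using 1
    abel
  obtain ⟨g, c, hg1, hg2⟩ := RCLike.geometric_hahn_banach_open (𝕜 := ℂ)
    (convex_ball (0 : Matrix n n ℂ) r) Metric.isOpen_ball ht hdisj
  simp only [mem_ball_zero_iff, RCLike.re_to_complex] at hg1 hg2
  have hc : 0 < c := by simpa using hg1 0 (by simpa using zero_lt_one.trans hr)
  have hg0 (H : Matrix n n ℂ) (hH : H.PosSemidef) : 0 ≤ (g H).re := by
    obtain ⟨P, h1, h2, -⟩ := exists_dominating_trace_le hT hcb isUnit_one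
    by_contra! hneg
    have hle : c ≤ (g (∑ a, P a)).re := by
      simpa using hg2 _ ⟨P, 0, h1, h2, .zero, rfl⟩
    -- adding this multiple of `H` to `∑ a, P a` would bring the value of `g` down to `c - 1`
    have hs : 0 ≤ (1 + (g (∑ a, P a)).re - c) / -(g H).re :=
      div_nonneg (by linarith) (by linarith)
    have h := hg2 _ ⟨P, ((1 + (g (∑ a, P a)).re - c) / -(g H).re) • H, h1, h2, hH.smul hs, rfl⟩
    rw [map_add, ← Complex.coe_smul, map_smul, smul_eq_mul, Complex.add_re, Complex.re_ofReal_mul,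
      div_mul_eq_mul_div, mul_div_assoc, div_neg, div_self hneg.ne] at h
    linarith
  have hτ : r * (g 1).re ≤ c := by
    by_contra! hlt
    have hpos : 0 < (g 1).re := pos_of_mul_pos_right (hc.trans hlt) (zero_lt_one.trans hr).le
    have hone : ‖(1 : Matrix n n ℂ)‖ ≤ 1 := by
      rw [← Matrix.diagonal_one, Matrix.l2_opNorm_diagonal]
      exact (pi_norm_le_iff_of_nonneg zero_le_one).2 fun i ↦ by simp
    have hnorm : ‖((c / (g 1).re : ℝ) : ℂ) • (1 : Matrix n n ℂ)‖ < r := by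
      rw [norm_smul, Complex.norm_real, Real.norm_of_nonneg (by positivity)]
      calc _ ≤ c / (g 1).re * 1 := by gcongr
        _ < r := by rwa [mul_one, div_lt_iff₀ hpos]
    have h := hg1 _ hnorm
    rw [map_smul, smul_eq_mul, Complex.re_ofReal_mul, div_mul_cancel₀ _ hpos.ne'] at h
    exact lt_irrefl _ h
  obtain ⟨Y, hY, hYg⟩ := exists_density g.toLinearMap hg0
  have hYtr : (g 1).re = Y.trace.re := by
    simpa using hYg 1 Matrix.isHermitian_one
  have hδ (δ : ℝ) (hδ : 0 < δ) : c ≤ (g 1).re + δ * Fintype.card n := by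
    -- the density is made invertible in order to apply `exists_dominating_trace_le`
    have hpd : (Y + δ • (1 : Matrix n n ℂ)).PosDef :=
      (Matrix.PosDef.one.smul hδ).posSemidef_add hY
    open scoped MatrixOrder in
    obtain ⟨B, hB, hBY⟩ := CStarAlgebra.isStrictlyPositive_iff_eq_star_mul_self.mp
      hpd.isStrictlyPositive
    rw [Matrix.star_eq_conjTranspose] at hBY
    obtain ⟨P, h1, h2, h3⟩ := exists_dominating_trace_le hT hcb hB
    have hP := Matrix.posSemidef_sum Finset.univ fun a _ ↦ (h1 a).of_sub_add (h2 a)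
    have hle : c ≤ (g (∑ a, P a)).re := by
      simpa using hg2 _ ⟨P, 0, h1, h2, .zero, rfl⟩
    have hgP := hYg _ hP.isHermitian
    rw [← hBY, add_mul, Matrix.trace_add, Matrix.trace_add, Matrix.smul_mul, one_mul,
      Matrix.trace_smul, Matrix.trace_smul, Matrix.trace_one] at h3
    have hPtr := mul_nonneg hδ.le hP.re_trace_nonneg
    simp only [Complex.add_re, Complex.real_smul, Complex.re_ofReal_mul,
      Complex.natCast_re] at h3
    simp only [ContinuousLinearMap.coe_coe] at hgP
    linarith
  have hcle : c ≤ (g 1).re := by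
    by_contra! hlt
    have hN : 0 < (Fintype.card n : ℝ) + 1 := by positivity
    have h := hδ ((c - (g 1).re) / (Fintype.card n + 1)) (div_pos (by linarith) hN)
    have h2 : (c - (g 1).re) / (Fintype.card n + 1) * Fintype.card n < c - (g 1).re := by
      rw [div_mul_eq_mul_div, div_lt_iff₀ hN]
      nlinarith
    linarith
  nlinarith

/-! ### Decomposition of complete contractions on `ℓ_∞^A` -/

/-- An incomplete measurement: positive operators whose sum is at most the identity. -/
def IsSubPOVM {A n : Type*} [Fintype A] [DecidableEq n] (E : A → Matrix n n ℂ) : Prop :=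
  (∀ a, (E a).PosSemidef) ∧ (1 - ∑ a, E a).PosSemidef

theorem IsSubPOVM.submatrix {A m n : Type*} [Fintype A] [DecidableEq m] [DecidableEq n]
    {E : A → Matrix n n ℂ} (hE : IsSubPOVM E) (e : m ≃ n) :
    IsSubPOVM fun a ↦ (E a).submatrix e e := by
  refine ⟨fun a ↦ (hE.1 a).submatrix e, ?_⟩
  convert! hE.2.submatrix e using 1
  ext i j
  simp [Matrix.sum_apply, Matrix.one_apply]

/-- The Hermitian dilation of a square matrix. -/
def hermitianDilation {n : Type*} (T : Matrix n n ℂ) : Matrix (n ⊕ n) (n ⊕ n) ℂ :=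
  Matrix.fromBlocks 0 T T.conjTranspose 0

theorem isHermitian_hermitianDilation {n : Type*} (T : Matrix n n ℂ) :
    (hermitianDilation T).IsHermitian := by
  simp [hermitianDilation, Matrix.IsHermitian, Matrix.fromBlocks_conjTranspose]

theorem norm_sum_kronecker_le_one_of_fin {A m n : Type*} [Fintype A] [Fintype m] [DecidableEq m]
    [Fintype n] [DecidableEq n] {T : A → Matrix n n ℂ}
    (hT : ∀ N (w : A → Matrix (Fin N) (Fin N) ℂ), (∀ a, ‖w a‖ ≤ 1) → ‖∑ a, w a ⊗ₖ T a‖ ≤ 1)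
    {w : A → Matrix m m ℂ} (hw : ∀ a, ‖w a‖ ≤ 1) : ‖∑ a, w a ⊗ₖ T a‖ ≤ 1 := by
  let e := Fintype.equivFin m
  have h := hT _ (fun a ↦ (w a).submatrix e.symm e.symm)
    fun a ↦ (l2_opNorm_submatrix_equiv_le _ _).trans (hw a)
  refine le_trans (le_of_eq ?_)
    ((l2_opNorm_submatrix_equiv_le _ (e.prodCongr (Equiv.refl n))).trans h)
  congr 1
  ext ⟨i, k⟩ ⟨j, l⟩
  simp [Matrix.sum_apply]

theorem form_kronecker_hermitianDilation {m n : Type*} [Fintype m] [Fintype n]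
    (w : Matrix m m ℂ) (T : Matrix n n ℂ) (u v : m × (n ⊕ n) → ℂ) :
    star u ⬝ᵥ (w ⊗ₖ hermitianDilation T).mulVec v =
      star (fun p : m × n ↦ u (p.1, .inl p.2)) ⬝ᵥ
          (w ⊗ₖ T).mulVec (fun p ↦ v (p.1, .inr p.2)) +
        star (fun p : m × n ↦ u (p.1, .inr p.2)) ⬝ᵥ
          (w ⊗ₖ T.conjTranspose).mulVec (fun p ↦ v (p.1, .inl p.2)) := by
  simp [dotProduct, Matrix.mulVec, Fintype.sum_prod_type, Fintype.sum_sum_type,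
    hermitianDilation, Finset.sum_add_distrib]

theorem dotProduct_self_prod_sum {m n : Type*} [Fintype m] [Fintype n]
    (u : m × (n ⊕ n) → ℂ) :
    star u ⬝ᵥ u =
      star (fun p : m × n ↦ u (p.1, .inl p.2)) ⬝ᵥ (fun p : m × n ↦ u (p.1, .inl p.2)) +
        star (fun p : m × n ↦ u (p.1, .inr p.2)) ⬝ᵥ (fun p : m × n ↦ u (p.1, .inr p.2)) := by
  simp [dotProduct, Fintype.sum_prod_type, Fintype.sum_sum_type, Finset.sum_add_distrib]

theorem norm_sum_kronecker_hermitianDilation_le_one {A m n : Type*} [Fintype A] [Fintype m]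
    [DecidableEq m] [Fintype n] [DecidableEq n] {T : A → Matrix n n ℂ}
    (hT : ∀ w : A → Matrix m m ℂ, (∀ a, ‖w a‖ ≤ 1) → ‖∑ a, w a ⊗ₖ T a‖ ≤ 1)
    {w : A → Matrix m m ℂ} (hw : ∀ a, ‖w a‖ ≤ 1) :
    ‖∑ a, w a ⊗ₖ hermitianDilation (T a)‖ ≤ 1 := by
  have h1 := hT w hw
  have h2 : ‖∑ a, w a ⊗ₖ (T a).conjTranspose‖ ≤ 1 := by
    have h := hT (fun a ↦ (w a).conjTranspose) fun a ↦ by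
      rw [Matrix.l2_opNorm_conjTranspose]; exact hw a
    rw [← Matrix.l2_opNorm_conjTranspose, Matrix.conjTranspose_sum] at h
    simpa only [Matrix.conjTranspose_kronecker, Matrix.conjTranspose_conjTranspose] using h
  rw [l2_opNorm_le_iff_form _ zero_le_one] at h1 h2 ⊢
  intro u v
  have hu := h1 (fun p ↦ u (p.1, .inl p.2)) (fun p ↦ v (p.1, .inr p.2))
  have hv := h2 (fun p ↦ u (p.1, .inr p.2)) (fun p ↦ v (p.1, .inl p.2))
  simp only [Matrix.sum_mulVec, dotProduct_sum] at hu hv ⊢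
  rw [Finset.sum_congr rfl fun a _ ↦ form_kronecker_hermitianDilation (w a) (T a) u v,
    Finset.sum_add_distrib, dotProduct_self_prod_sum u, dotProduct_self_prod_sum v]
  simp only [Complex.add_re]
  linarith

/-- Up to a factor `r > 1`, the Hermitian dilation of a complete contraction on `ℓ_∞^A` is a
difference of two incomplete measurements. -/
theorem exists_subPOVM_sub {A n : Type*} [Fintype A] [Fintype n] [DecidableEq n]
    {T : A → Matrix n n ℂ}
    (hT : ∀ N (w : A → Matrix (Fin N) (Fin N) ℂ), (∀ a, ‖w a‖ ≤ 1) → ‖∑ a, w a ⊗ₖ T a‖ ≤ 1)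
    {r : ℝ} (hr : 1 < r) :
    ∃ E F : A → Matrix (n ⊕ n) (n ⊕ n) ℂ, IsSubPOVM E ∧ IsSubPOVM F ∧
      ∀ a, hermitianDilation (T a) = r • (E a - F a) := by
  have hr0 : 0 < r := zero_lt_one.trans hr
  obtain ⟨P, h1, h2, h3⟩ := exists_dominating_family
    (fun a ↦ isHermitian_hermitianDilation (T a))
    (fun W hW ↦ norm_sum_kronecker_hermitianDilation_le_one
      (fun w hw ↦ norm_sum_kronecker_le_one_of_fin hT hw) hW) hr
  have hs : (0 : ℝ) ≤ (2 * r)⁻¹ := by positivity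
  have hE (a : A) := (h2 a).smul hs
  have hF (a : A) := (h1 a).smul hs
  have h3' := h3.smul (inv_nonneg.2 hr0.le)
  rw [smul_sub, smul_smul, inv_mul_cancel₀ hr0.ne', one_smul] at h3'
  have hsum : ∑ a, (2 * r)⁻¹ • (P a + hermitianDilation (T a)) +
      ∑ a, (2 * r)⁻¹ • (P a - hermitianDilation (T a)) = r⁻¹ • ∑ a, P a := by
    rw [← Finset.sum_add_distrib, Finset.smul_sum]
    refine Finset.sum_congr rfl fun a _ ↦ ?_
    rw [mul_inv]
    module
  -- each of the two families is bounded by their sum `r⁻¹ • P`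
  refine ⟨fun a ↦ (2 * r)⁻¹ • (P a + hermitianDilation (T a)),
    fun a ↦ (2 * r)⁻¹ • (P a - hermitianDilation (T a)), ⟨hE, ?_⟩, ⟨hF, ?_⟩, fun a ↦ ?_⟩
  · convert! h3'.add (Matrix.posSemidef_sum Finset.univ fun a _ ↦ hF a) using 1
    rw [← hsum]; abel
  · convert! h3'.add (Matrix.posSemidef_sum Finset.univ fun a _ ↦ hE a) using 1
    rw [← hsum]; abel
  · rw [← smul_sub, smul_smul, mul_inv, mul_left_comm, mul_inv_cancel₀ hr0.ne']
    module

section Entangled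

/-! ### Bell operators and the incomplete entangled value -/

variable {X Y A B : Type*} [Fintype X] [Fintype Y] [Fintype A] [Fintype B]

theorem BellFunctional.enorm_eval_le (M : BellFunctional X Y A B) {P : X → Y → A → B → ℝ}
    (hP : P ∈ Set.Icc 0 1) :
    ‖M.eval P‖ₑ ≤ ENNReal.ofReal (∑ x, ∑ y, ∑ a, ∑ b, |M x y a b|) := by
  rw [Real.enorm_eq_ofReal_abs]
  refine ENNReal.ofReal_le_ofReal ?_
  refine (Finset.abs_sum_le_sum_abs _ _).trans (Finset.sum_le_sum fun x _ ↦ ?_)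
  refine (Finset.abs_sum_le_sum_abs _ _).trans (Finset.sum_le_sum fun y _ ↦ ?_)
  refine (Finset.abs_sum_le_sum_abs _ _).trans (Finset.sum_le_sum fun a _ ↦ ?_)
  refine (Finset.abs_sum_le_sum_abs _ _).trans (Finset.sum_le_sum fun b _ ↦ ?_)
  have h0 : 0 ≤ P x y a b := hP.1 x y a b
  have h1 : P x y a b ≤ 1 := hP.2 x y a b
  rw [abs_mul, abs_of_nonneg h0]
  exact mul_le_of_le_one_right (abs_nonneg _) h1

/-- The Bell operator `∑ M_{x,y}^{a,b} E_x^a ⊗ F_y^b` of two families of matrices. -/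
def BellFunctional.operator (M : BellFunctional X Y A B) {m n : Type*}
    (E : X → A → Matrix m m ℂ) (F : Y → B → Matrix n n ℂ) : Matrix (m × n) (m × n) ℂ :=
  ∑ x, ∑ y, ∑ a, ∑ b, (M x y a b : ℂ) • (E x a ⊗ₖ F y b)

theorem BellFunctional.form_operator (M : BellFunctional X Y A B) {m n : Type*} [Fintype m]
    [Fintype n] (E : X → A → Matrix m m ℂ) (F : Y → B → Matrix n n ℂ) (u v : m × n → ℂ) :
    star u ⬝ᵥ (M.operator E F).mulVec v =
      ∑ x, ∑ y, ∑ a, ∑ b, (M x y a b : ℂ) * (star u ⬝ᵥ (E x a ⊗ₖ F y b).mulVec v) := by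
  simp [BellFunctional.operator, Matrix.sum_mulVec, dotProduct_sum, Matrix.smul_mulVec]

theorem BellFunctional.re_form_operator (M : BellFunctional X Y A B) {m n : Type*} [Fintype m]
    [Fintype n] (E : X → A → Matrix m m ℂ) (F : Y → B → Matrix n n ℂ) (u v : m × n → ℂ) :
    (star u ⬝ᵥ (M.operator E F).mulVec v).re =
      M.eval fun x y a b ↦ (star u ⬝ᵥ (E x a ⊗ₖ F y b).mulVec v).re := by
  simp [form_operator, BellFunctional.eval]

theorem BellFunctional.kroneckerMap_complexTensor [DecidableEq X] [DecidableEq Y] [DecidableEq A]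
    [DecidableEq B] (M : BellFunctional X Y A B) {d : ℕ}
    (T : (X → A → ℂ) →ₗ[ℂ] Matrix (Fin d) (Fin d) ℂ)
    (S : (Y → B → ℂ) →ₗ[ℂ] Matrix (Fin d) (Fin d) ℂ) :
    kroneckerMap T S M.complexTensor =
      M.operator (fun x a ↦ T (Pi.single x (Pi.single a 1)))
        (fun y b ↦ S (Pi.single y (Pi.single b 1))) := by
  simp only [complexTensor, operator, map_sum, map_smul, kroneckerMap, TensorProduct.lift.tmul,
    LinearMap.compl₁₂_apply]
  rfl

theorem toEuclideanLin_form {n : Type*} [Fintype n] [DecidableEq n] (G : Matrix n n ℂ)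
    (ψ : EuclideanSpace ℂ n) :
    inner ℂ ψ (Matrix.toEuclideanLin G ψ) = star ψ.ofLp ⬝ᵥ G.mulVec ψ.ofLp := by
  rw [EuclideanSpace.inner_eq_star_dotProduct, dotProduct_comm]
  rfl

theorem IsSubPOVM.posSemidef_one_sub {n : Type*} [DecidableEq n] {E : A → Matrix n n ℂ}
    (hE : IsSubPOVM E) (a : A) : (1 - E a).PosSemidef := by
  classical
  convert! hE.2.add (Matrix.posSemidef_sum (Finset.univ.erase a) fun a' _ ↦ hE.1 a') using 1
  rw [← Finset.add_sum_erase _ _ (Finset.mem_univ a)]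
  abel

theorem form_kronecker_mem_Icc {m n : Type*} [Fintype m] [DecidableEq m] [Fintype n]
    [DecidableEq n] {E : A → Matrix m m ℂ} (hE : IsSubPOVM E) {F : B → Matrix n n ℂ}
    (hF : IsSubPOVM F) (a : A) (b : B) (u : m × n → ℂ) :
    0 ≤ star u ⬝ᵥ (E a ⊗ₖ F b).mulVec u ∧
      star u ⬝ᵥ (E a ⊗ₖ F b).mulVec u ≤ star u ⬝ᵥ u := by
  refine ⟨((hE.1 a).kronecker (hF.1 b)).dotProduct_mulVec_nonneg u, ?_⟩
  have h := (((hE.posSemidef_one_sub a).kronecker (Matrix.PosSemidef.one (n := n) (R := ℂ))).add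
    ((hE.1 a).kronecker (hF.posSemidef_one_sub b))).dotProduct_mulVec_nonneg u
  have he : (1 - E a) ⊗ₖ (1 : Matrix n n ℂ) + E a ⊗ₖ (1 - F b) = 1 - E a ⊗ₖ F b := by
    ext ⟨i, k⟩ ⟨j, l⟩
    by_cases hij : i = j <;> by_cases hkl : k = l <;>
      simp [hij, hkl, mul_sub, neg_add_eq_sub]
  rwa [he, Matrix.sub_mulVec, Matrix.one_mulVec, dotProduct_sub, sub_nonneg] at h

theorem mem_incompleteQuantum_iff {X Y A B : Type*} [Fintype A] [Fintype B]
    {P : X → Y → A → B → ℝ} :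
    P ∈ incompleteQuantum X Y A B ↔
      ∃ (d : ℕ) (ψ : Fin d × Fin d → ℂ) (E : X → A → Matrix (Fin d) (Fin d) ℂ)
        (F : Y → B → Matrix (Fin d) (Fin d) ℂ), (star ψ ⬝ᵥ ψ).re ≤ 1 ∧
        (∀ x, IsSubPOVM (E x)) ∧ (∀ y, IsSubPOVM (F y)) ∧
        ∀ x y a b, (P x y a b : ℂ) = star ψ ⬝ᵥ (E x a ⊗ₖ F y b).mulVec ψ := by
  have hn {d : ℕ} (ψ : EuclideanSpace ℂ (Fin d × Fin d)) :
      ‖ψ‖ ≤ 1 ↔ (star ψ.ofLp ⬝ᵥ ψ.ofLp).re ≤ 1 := by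
    rw [re_star_dotProduct_self, WithLp.toLp_ofLp, sq_le_one_iff₀ (norm_nonneg _)]
  constructor
  · rintro ⟨d, ψ, E, F, hψ, hE, hE1, hF, hF1, hP⟩
    exact ⟨d, ψ.ofLp, E, F, (hn ψ).1 hψ, fun x ↦ ⟨hE x, hE1 x⟩, fun y ↦ ⟨hF y, hF1 y⟩,
      fun x y a b ↦ by rw [hP, toEuclideanLin_form]⟩
  · rintro ⟨d, ψ, E, F, hψ, hE, hF, hP⟩
    exact ⟨d, WithLp.toLp 2 ψ, E, F, (hn _).2 hψ, fun x ↦ (hE x).1, fun x ↦ (hE x).2,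
      fun y ↦ (hF y).1, fun y ↦ (hF y).2, fun x y a b ↦ by rw [hP, toEuclideanLin_form]⟩

theorem incompleteQuantum_subset_Icc {X Y A B : Type*} [Fintype A] [Fintype B] :
    incompleteQuantum X Y A B ⊆ Set.Icc 0 1 := by
  intro P hP
  obtain ⟨d, ψ, E, F, hψ, hE, hF, h⟩ := mem_incompleteQuantum_iff.1 hP
  have key (x y a b) : 0 ≤ P x y a b ∧ P x y a b ≤ 1 := by
    have hb := form_kronecker_mem_Icc (hE x) (hF y) a b ψ
    rw [← h, Complex.le_def, Complex.le_def] at hb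
    exact ⟨hb.1.1, hb.2.1.trans hψ⟩
  exact ⟨fun x y a b ↦ (key x y a b).1, fun x y a b ↦ (key x y a b).2⟩

theorem BellFunctional.incEntangledValue_ne_top (M : BellFunctional X Y A B) :
    M.incEntangledValue ≠ ⊤ :=
  ne_top_of_le_ne_top ENNReal.ofReal_ne_top
    (iSup₂_le fun _ hP ↦ M.enorm_eval_le (incompleteQuantum_subset_Icc hP))

/-- The numerical range of a Bell operator of incomplete measurements, over an arbitrary index
type and for unnormalized vectors, is bounded by the incomplete entangled value. -/
theorem BellFunctional.abs_re_form_operator_le (M : BellFunctional X Y A B) {n : Type*}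
    [Fintype n] [DecidableEq n] {E : X → A → Matrix n n ℂ} (hE : ∀ x, IsSubPOVM (E x))
    {F : Y → B → Matrix n n ℂ} (hF : ∀ y, IsSubPOVM (F y)) (u : n × n → ℂ) :
    |(star u ⬝ᵥ (M.operator E F).mulVec u).re| ≤
      M.incEntangledValue.toReal * (star u ⬝ᵥ u).re := by
  obtain hu | hu := (re_star_dotProduct_self_nonneg u).eq_or_lt
  · have : u = 0 := by
      rw [re_star_dotProduct_self, eq_comm, sq_eq_zero_iff, norm_eq_zero] at hu
      simpa using congrArg WithLp.ofLp hu
    simp [this]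
  set t := (star u ⬝ᵥ u).re
  let e := Fintype.equivFin n
  -- normalize `u` and transport it to `Fin d`, where `d` is the cardinality of the index type
  let s : ℝ := (√t)⁻¹
  have hs : s * s * t = 1 := by
    simp only [s]
    rw [← mul_inv, Real.mul_self_sqrt hu.le, inv_mul_cancel₀ hu.ne']
  let ψ : Fin (Fintype.card n) × Fin (Fintype.card n) → ℂ :=
    ((s : ℂ) • u) ∘ (e.prodCongr e).symm
  have hsc (G : Matrix (n × n) (n × n) ℂ) :
      star ((s : ℂ) • u) ⬝ᵥ G.mulVec ((s : ℂ) • u) = (s * s : ℝ) * (star u ⬝ᵥ G.mulVec u) := by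
    simp [Matrix.mulVec_smul, star_smul, smul_dotProduct, dotProduct_smul, mul_assoc]
  have hstar : star ψ = star ((s : ℂ) • u) ∘ (e.prodCongr e).symm := rfl
  have hψ : (star ψ ⬝ᵥ ψ).re ≤ 1 := by
    have h := hsc 1
    rw [Matrix.one_mulVec, Matrix.one_mulVec] at h
    rw [hstar, comp_equiv_dotProduct_comp_equiv, h, Complex.re_ofReal_mul]
    exact hs.le
  have hform (x y a b) : star ψ ⬝ᵥ
      ((E x a).submatrix e.symm e.symm ⊗ₖ (F y b).submatrix e.symm e.symm).mulVec ψ =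
        (s * s : ℝ) * (star u ⬝ᵥ (E x a ⊗ₖ F y b).mulVec u) := by
    rw [← hsc, hstar]
    have : (E x a).submatrix e.symm e.symm ⊗ₖ (F y b).submatrix e.symm e.symm =
        (E x a ⊗ₖ F y b).submatrix (e.prodCongr e).symm (e.prodCongr e).symm := rfl
    rw [this, Matrix.submatrix_mulVec_equiv, comp_equiv_dotProduct_comp_equiv]
    simp only [ψ, Function.comp_assoc, Equiv.symm_symm, Equiv.symm_comp_self, Function.comp_id]
  have hmem : (fun x y a b ↦ s * s * (star u ⬝ᵥ (E x a ⊗ₖ F y b).mulVec u).re) ∈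
      incompleteQuantum X Y A B := by
    refine mem_incompleteQuantum_iff.2 ⟨_, ψ, fun x a ↦ (E x a).submatrix e.symm e.symm,
      fun y b ↦ (F y b).submatrix e.symm e.symm, hψ, fun x ↦ (hE x).submatrix e.symm,
      fun y ↦ (hF y).submatrix e.symm, fun x y a b ↦ ?_⟩
    have him := (Complex.le_def.1 (form_kronecker_mem_Icc (hE x) (hF y) a b u).1).2
    rw [hform, Complex.ofReal_mul]
    congr 1
    exact Complex.ext rfl him
  have heval : M.eval (fun x y a b ↦ s * s * (star u ⬝ᵥ (E x a ⊗ₖ F y b).mulVec u).re) =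
      s * s * (star u ⬝ᵥ (M.operator E F).mulVec u).re := by
    simp only [re_form_operator, BellFunctional.eval, Finset.mul_sum]
    simp only [mul_left_comm]
  have h : ‖s * s * (star u ⬝ᵥ (M.operator E F).mulVec u).re‖ₑ ≤ M.incEntangledValue := by
    rw [← heval]
    exact le_iSup₂_of_le _ hmem le_rfl
  rw [Real.enorm_eq_ofReal_abs, ENNReal.ofReal_le_iff_le_toReal M.incEntangledValue_ne_top,
    abs_mul, abs_mul_self] at h
  calc |(star u ⬝ᵥ (M.operator E F).mulVec u).re|
      = s * s * t * |(star u ⬝ᵥ (M.operator E F).mulVec u).re| := by rw [hs, one_mul]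
    _ = s * s * |(star u ⬝ᵥ (M.operator E F).mulVec u).re| * t := by ring
    _ ≤ _ := mul_le_mul_of_nonneg_right h hu.le

/-- Incomplete measurements define complete contractions on `ℓ_1^X(ℓ_∞^A)`. -/
theorem exists_linearMap_of_subPOVM [DecidableEq X] [DecidableEq A] {d : ℕ}
    {E : X → A → Matrix (Fin d) (Fin d) ℂ} (hE : ∀ x, IsSubPOVM (E x)) :
    ∃ T : (X → A → ℂ) →ₗ[ℂ] Matrix (Fin d) (Fin d) ℂ,
      (∀ x a, T (Pi.single x (Pi.single a 1)) = E x a) ∧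
      cbNorm (l1LinfNorms X A) (matNorms d) T ≤ 1 := by
  let T : (X → A → ℂ) →ₗ[ℂ] Matrix (Fin d) (Fin d) ℂ :=
    ∑ x, ∑ a, (LinearMap.toSpanSingleton ℂ _ (E x a)).comp
      ((LinearMap.proj a : (A → ℂ) →ₗ[ℂ] ℂ).comp (LinearMap.proj x))
  have hT (x a) : T (Pi.single x (Pi.single a 1)) = E x a := by
    simp [T, LinearMap.sum_apply, Pi.single_apply, ite_apply]
  refine ⟨T, hT, (cbNorm_l1LinfNorms_le_one_iff T).2 fun x n w hw ↦ ?_⟩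
  simp only [hT]
  exact norm_sum_kronecker_le_one hw (hE x).1 (hE x).2

theorem BellFunctional.incEntangledValue_le_minNorm [DecidableEq X] [DecidableEq Y]
    [DecidableEq A] [DecidableEq B] (M : BellFunctional X Y A B) :
    M.incEntangledValue ≤ minNorm (l1LinfNorms X A) (l1LinfNorms Y B) M.complexTensor := by
  refine iSup₂_le fun P hP ↦ ?_
  obtain ⟨d, ψ, E, F, hψ, hE, hF, h⟩ := mem_incompleteQuantum_iff.1 hP
  obtain ⟨T, hT, hTcb⟩ := exists_linearMap_of_subPOVM hE
  obtain ⟨S, hS, hScb⟩ := exists_linearMap_of_subPOVM hF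
  refine le_trans ?_ (le_iSup₂_of_le d T <| le_iSup₂_of_le S hTcb <| le_iSup_of_le hScb le_rfl)
  rw [M.kroneckerMap_complexTensor, show (fun x a ↦ T (Pi.single x (Pi.single a 1))) = E from
    funext₂ hT, show (fun y b ↦ S (Pi.single y (Pi.single b 1))) = F from funext₂ hS]
  have heval : M.eval P = (star ψ ⬝ᵥ (M.operator E F).mulVec ψ).re := by
    rw [M.re_form_operator]
    congr 1
    ext x y a b
    rw [← h, Complex.ofReal_re]
  rw [← ofReal_norm, ← ofReal_norm, heval]
  refine ENNReal.ofReal_le_ofReal ?_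
  have hb := (l2_opNorm_le_iff_form (M.operator E F) (norm_nonneg _)).1 le_rfl
  have h1 := hb ψ ψ
  -- the sign change bounds the quadratic form from below
  have h2 := hb (-ψ) ψ
  rw [star_neg, neg_dotProduct_neg, neg_dotProduct, Complex.neg_re] at h2
  have hle := mul_le_mul_of_nonneg_left hψ (norm_nonneg (M.operator E F))
  exact abs_le.2 ⟨by linarith, by linarith⟩

/-- The Bell operator of complete contractions `T`, `S` is a corner of the Bell operator of their
Hermitian dilations, whose quadratic form splits into four Bell operators of incomplete
measurements. -/
theorem BellFunctional.norm_operator_le (M : BellFunctional X Y A B) {n : Type*} [Fintype n]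
    [DecidableEq n] {T : X → A → Matrix n n ℂ} {S : Y → B → Matrix n n ℂ}
    (hT : ∀ x N (w : A → Matrix (Fin N) (Fin N) ℂ), (∀ a, ‖w a‖ ≤ 1) →
      ‖∑ a, w a ⊗ₖ T x a‖ ≤ 1)
    (hS : ∀ y N (w : B → Matrix (Fin N) (Fin N) ℂ), (∀ b, ‖w b‖ ≤ 1) →
      ‖∑ b, w b ⊗ₖ S y b‖ ≤ 1) {r : ℝ} (hr : 1 < r) :
    ‖M.operator T S‖ ≤ r ^ 2 * (4 * M.incEntangledValue.toReal) := by
  choose E E' hE hE' hTE using fun x ↦ exists_subPOVM_sub (hT x) hr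
  choose F F' hF hF' hSF using fun y ↦ exists_subPOVM_sub (hS y) hr
  rw [l2_opNorm_le_iff_form _ (by positivity)]
  intro u v
  -- the vector `u ⊕ v` in the diagonal blocks of `(ℂⁿ ⊕ ℂⁿ) ⊗ (ℂⁿ ⊕ ℂⁿ)`
  let ψ : (n ⊕ n) × (n ⊕ n) → ℂ
    | (.inl i, .inl j) => u (i, j)
    | (.inr i, .inr j) => v (i, j)
    | _ => 0
  have hψ : star ψ ⬝ᵥ ψ = star u ⬝ᵥ u + star v ⬝ᵥ v := by
    simp [dotProduct, Fintype.sum_prod_type, Fintype.sum_sum_type, ψ]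
  have hdil (P Q : Matrix n n ℂ) :
      star ψ ⬝ᵥ (hermitianDilation P ⊗ₖ hermitianDilation Q).mulVec ψ =
        star u ⬝ᵥ (P ⊗ₖ Q).mulVec v + star (star u ⬝ᵥ (P ⊗ₖ Q).mulVec v) := by
    have h1 : star (star u ⬝ᵥ (P ⊗ₖ Q).mulVec v) =
        star v ⬝ᵥ (P.conjTranspose ⊗ₖ Q.conjTranspose).mulVec u := by
      rw [← Matrix.conjTranspose_kronecker, Matrix.star_dotProduct, Matrix.star_mulVec,
        ← Matrix.dotProduct_mulVec, star_star]
    rw [h1]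
    simp [dotProduct, Matrix.mulVec, Fintype.sum_prod_type, Fintype.sum_sum_type,
      hermitianDilation, ψ]
  have hop : 2 * (star u ⬝ᵥ (M.operator T S).mulVec v).re =
      r ^ 2 * ((star ψ ⬝ᵥ (M.operator E F).mulVec ψ).re
        - (star ψ ⬝ᵥ (M.operator E F').mulVec ψ).re
        - (star ψ ⬝ᵥ (M.operator E' F).mulVec ψ).re
        + (star ψ ⬝ᵥ (M.operator E' F').mulVec ψ).re) := by
    have hterm (x y a b) : 2 * (star u ⬝ᵥ (T x a ⊗ₖ S y b).mulVec v).re =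
        r ^ 2 * ((star ψ ⬝ᵥ (E x a ⊗ₖ F y b).mulVec ψ).re
          - (star ψ ⬝ᵥ (E x a ⊗ₖ F' y b).mulVec ψ).re
          - (star ψ ⬝ᵥ (E' x a ⊗ₖ F y b).mulVec ψ).re
          + (star ψ ⬝ᵥ (E' x a ⊗ₖ F' y b).mulVec ψ).re) := by
      have h := congrArg Complex.re (hdil (T x a) (S y b))
      have hk : hermitianDilation (T x a) ⊗ₖ hermitianDilation (S y b) =
          (r ^ 2) • (E x a ⊗ₖ F y b - E x a ⊗ₖ F' y b - E' x a ⊗ₖ F y b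
            + E' x a ⊗ₖ F' y b) := by
        rw [hTE, hSF]
        ext ⟨i, k⟩ ⟨j, l⟩
        simp
        ring
      rw [hk] at h
      simp only [Matrix.smul_mulVec, Matrix.add_mulVec, Matrix.sub_mulVec, dotProduct_smul,
        dotProduct_add, dotProduct_sub, Complex.real_smul, Complex.re_ofReal_mul, Complex.add_re,
        Complex.sub_re, Complex.star_def, Complex.conj_re] at h
      linarith
    simp only [re_form_operator, BellFunctional.eval, ← Finset.sum_sub_distrib,
      ← Finset.sum_add_distrib, Finset.mul_sum]
    refine Finset.sum_congr rfl fun x _ ↦ Finset.sum_congr rfl fun y _ ↦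
      Finset.sum_congr rfl fun a _ ↦ Finset.sum_congr rfl fun b _ ↦ ?_
    linear_combination M x y a b * hterm x y a b
  have hb1 := abs_le.1 (M.abs_re_form_operator_le hE hF ψ)
  have hb2 := abs_le.1 (M.abs_re_form_operator_le hE hF' ψ)
  have hb3 := abs_le.1 (M.abs_re_form_operator_le hE' hF ψ)
  have hb4 := abs_le.1 (M.abs_re_form_operator_le hE' hF' ψ)
  rw [hop, ← Complex.add_re, ← hψ, mul_assoc]
  refine mul_le_mul_of_nonneg_left ?_ (sq_nonneg r)
  linarith

theorem BellFunctional.minNorm_le [DecidableEq X] [DecidableEq Y]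
    [DecidableEq A] [DecidableEq B] (M : BellFunctional X Y A B) :
    minNorm (l1LinfNorms X A) (l1LinfNorms Y B) M.complexTensor ≤ 4 * M.incEntangledValue := by
  refine iSup₂_le fun d T ↦ iSup₂_le fun S hT ↦ iSup_le fun hS ↦ ?_
  rw [cbNorm_l1LinfNorms_le_one_iff] at hT hS
  rw [M.kroneckerMap_complexTensor, ← ofReal_norm]
  refine ENNReal.ofReal_le_of_le_toReal ?_
  rw [ENNReal.toReal_mul]
  have hlim : Filter.Tendsto (fun r : ℝ ↦ r ^ 2 * (4 * M.incEntangledValue.toReal))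
      (nhdsWithin 1 (Set.Ioi 1)) (nhds (1 ^ 2 * (4 * M.incEntangledValue.toReal))) :=
    ((continuous_id.pow 2).mul continuous_const).continuousAt.tendsto.mono_left nhdsWithin_le_nhds
  refine ge_of_tendsto (by simpa using hlim) ?_
  filter_upwards [self_mem_nhdsWithin] with r hr
  exact M.norm_operator_le hT hS hr

end Entangled

section Classical

/-! ### The classical value and the injective norm -/

variable {X Y A B : Type*} [Fintype X] [Fintype Y] [Fintype A] [Fintype B]

/-- The unit ball of the dual of `ℓ_1^X(ℓ_∞^A)` is that of `ℓ_∞^X(ℓ_1^A)`. -/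
theorem norm_dual_realL1Linf_le_one_iff [DecidableEq X] [DecidableEq A]
    (φ : StrongDual ℝ (RealL1Linf X A)) :
    ‖φ‖ ≤ 1 ↔ ∀ x, ∑ a, |φ (WithLp.toLp 1 (Pi.single x (Pi.single a 1)))| ≤ 1 := by
  have hexp (f : RealL1Linf X A) :
      φ f = ∑ x, ∑ a, f x a * φ (WithLp.toLp 1 (Pi.single x (Pi.single a 1))) := by
    conv_lhs => rw [show f = ∑ x, ∑ a, f x a •
        (WithLp.toLp 1 (Pi.single x (Pi.single a 1)) : RealL1Linf X A) by
      ext x a; simp [Finset.sum_apply, Pi.single_apply, ite_apply]]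
    simp
  constructor
  · intro h x
    -- the signs of `φ` at the coordinate `x` attain the sum
    let s : A → ℝ := fun a ↦ SignType.sign (φ (WithLp.toLp 1 (Pi.single x (Pi.single a 1))))
    let f : RealL1Linf X A := WithLp.toLp 1 (Pi.single x s)
    have hs : ‖s‖ ≤ 1 := by
      refine (pi_norm_le_iff_of_nonneg zero_le_one).2 fun a ↦ ?_
      have hsign (σ : SignType) : ‖(σ : ℝ)‖ ≤ 1 := by cases σ <;> simp
      exact hsign _
    have hf : ‖f‖ ≤ 1 := by
      exact (PiLp.norm_single 1 (fun _ : X ↦ A → ℝ) x s).trans_le hs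
    have hφ : φ f = ∑ a, |φ (WithLp.toLp 1 (Pi.single x (Pi.single a 1)))| := by
      rw [hexp, Finset.sum_eq_single x (fun x' _ hx ↦ by simp [f, hx]) (by simp)]
      simp [f, s, sign_mul_self]
    rw [← hφ]
    calc φ f ≤ ‖φ f‖ := le_abs_self _
      _ ≤ ‖φ‖ * ‖f‖ := φ.le_opNorm f
      _ ≤ 1 := mul_le_one₀ h (norm_nonneg _) hf
  · intro h
    refine φ.opNorm_le_bound zero_le_one fun f ↦ ?_
    rw [hexp, one_mul, PiLp.norm_eq_of_L1]
    refine (Finset.abs_sum_le_sum_abs _ _).trans (Finset.sum_le_sum fun x _ ↦ ?_)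
    refine (Finset.abs_sum_le_sum_abs _ _).trans ?_
    calc _ ≤ ∑ a, ‖f x‖ * |φ (WithLp.toLp 1 (Pi.single x (Pi.single a 1)))| := by
          refine Finset.sum_le_sum fun a _ ↦ ?_
          rw [abs_mul]
          exact mul_le_mul_of_nonneg_right (norm_le_pi_norm (f x) a) (abs_nonneg _)
      _ ≤ ‖f x‖ := by
          rw [← Finset.mul_sum]
          exact mul_le_of_le_one_right (norm_nonneg _) (h x)

theorem BellFunctional.dualDistrib_realTensor [DecidableEq X] [DecidableEq Y] [DecidableEq A]
    [DecidableEq B] (M : BellFunctional X Y A B) (φ : StrongDual ℝ (RealL1Linf X A))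
    (χ : StrongDual ℝ (RealL1Linf Y B)) :
    TensorProduct.dualDistrib ℝ _ _ (φ.toLinearMap ⊗ₜ[ℝ] χ.toLinearMap) M.realTensor =
      M.eval fun x y a b ↦ φ (WithLp.toLp 1 (Pi.single x (Pi.single a 1))) *
        χ (WithLp.toLp 1 (Pi.single y (Pi.single b 1))) := by
  simp [realTensor, BellFunctional.eval]

theorem exists_dual_realL1Linf [DecidableEq X] [DecidableEq A] {p : X → A → ℝ}
    (hp : p ∈ incompleteDist X A) :
    ∃ φ : StrongDual ℝ (RealL1Linf X A), ‖φ‖ ≤ 1 ∧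
      ∀ x a, φ (WithLp.toLp 1 (Pi.single x (Pi.single a 1))) = p x a := by
  let φ : StrongDual ℝ (RealL1Linf X A) :=
    ∑ x, ∑ a, p x a • ((ContinuousLinearMap.proj a : (A → ℝ) →L[ℝ] ℝ).comp
      (PiLp.proj 1 (fun _ : X ↦ A → ℝ) x))
  have hφ (x a) : φ (WithLp.toLp 1 (Pi.single x (Pi.single a 1))) = p x a := by
    simp [φ, Pi.single_apply, ite_apply]
  refine ⟨φ, (norm_dual_realL1Linf_le_one_iff φ).2 fun x ↦ ?_, hφ⟩
  simp only [hφ, abs_of_nonneg (hp.1 x _)]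
  exact hp.2 x

theorem le_one_of_mem_incompleteDist {X A : Type*} [Fintype A] {p : X → A → ℝ}
    (hp : p ∈ incompleteDist X A) (x : X) (a : A) : p x a ≤ 1 :=
  (Finset.single_le_sum (fun a _ ↦ hp.1 x a) (Finset.mem_univ a)).trans (hp.2 x)

theorem incompleteClassical_subset_Icc {X Y A B : Type*} [Fintype A] [Fintype B] :
    incompleteClassical X Y A B ⊆ Set.Icc 0 1 := by
  refine convexHull_min ?_ (convex_Icc 0 1)
  rintro _ ⟨p, hp, q, hq, rfl⟩
  exact ⟨fun x y a b ↦ mul_nonneg (hp.1 x a) (hq.1 y b),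
    fun x y a b ↦ mul_le_one₀ (le_one_of_mem_incompleteDist hp x a) (hq.1 y b)
      (le_one_of_mem_incompleteDist hq y b)⟩

theorem BellFunctional.eval_add_smul (M : BellFunctional X Y A B) (P Q : X → Y → A → B → ℝ)
    (s t : ℝ) : M.eval (s • P + t • Q) = s * M.eval P + t * M.eval Q := by
  simp only [BellFunctional.eval, Finset.mul_sum, ← Finset.sum_add_distrib, Pi.add_apply,
    Pi.smul_apply, smul_eq_mul]
  refine Finset.sum_congr rfl fun x _ ↦ Finset.sum_congr rfl fun y _ ↦
    Finset.sum_congr rfl fun a _ ↦ Finset.sum_congr rfl fun b _ ↦ ?_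
  ring

theorem BellFunctional.incValue_le_injectiveNorm [DecidableEq X] [DecidableEq Y] [DecidableEq A]
    [DecidableEq B] (M : BellFunctional X Y A B) :
    M.incValue ≤ injectiveNorm ℝ M.realTensor := by
  refine iSup₂_le fun P hP ↦ ?_
  let s : Set (X → Y → A → B → ℝ) := {P | ‖M.eval P‖ₑ ≤ injectiveNorm ℝ M.realTensor}
  have hs : Convex ℝ s := by
    intro P hP Q hQ p q hp hq hpq
    simp only [s, Set.mem_ofPred_eq] at hP hQ ⊢
    rw [M.eval_add_smul]
    calc _ ≤ ‖p‖ₑ * ‖M.eval P‖ₑ + ‖q‖ₑ * ‖M.eval Q‖ₑ := by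
          rw [← enorm_mul, ← enorm_mul]; exact enorm_add_le _ _
      _ ≤ ‖p‖ₑ * injectiveNorm ℝ M.realTensor + ‖q‖ₑ * injectiveNorm ℝ M.realTensor := by gcongr
      _ = _ := by
          rw [← add_mul, Real.enorm_of_nonneg hp, Real.enorm_of_nonneg hq,
            ← ENNReal.ofReal_add hp hq, hpq, ENNReal.ofReal_one, one_mul]
  refine convexHull_min ?_ hs hP
  rintro _ ⟨p, hp, q, hq, rfl⟩
  obtain ⟨φ, hφ, hφp⟩ := exists_dual_realL1Linf hp
  obtain ⟨χ, hχ, hχq⟩ := exists_dual_realL1Linf hq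
  have hval : M.eval (fun x y a b ↦ p x a * q y b) =
      TensorProduct.dualDistrib ℝ _ _ (φ.toLinearMap ⊗ₜ[ℝ] χ.toLinearMap) M.realTensor := by
    rw [M.dualDistrib_realTensor]
    simp only [hφp, hχq]
  simp only [s, Set.mem_ofPred_eq, hval, injectiveNorm]
  refine le_iSup_of_le φ ?_
  refine le_iSup_of_le χ ?_
  exact le_iSup_of_le hφ (le_iSup_of_le hχ le_rfl)

/-- A functional in the unit ball splits into its positive and negative parts. -/
theorem exists_incompleteDist_sub [DecidableEq X] [DecidableEq A]
    {φ : StrongDual ℝ (RealL1Linf X A)} (hφ : ‖φ‖ ≤ 1) :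
    ∃ p ∈ incompleteDist X A, ∃ q ∈ incompleteDist X A,
      ∀ x a, φ (WithLp.toLp 1 (Pi.single x (Pi.single a 1))) = p x a - q x a := by
  rw [norm_dual_realL1Linf_le_one_iff] at hφ
  refine ⟨fun x a ↦ (φ (WithLp.toLp 1 (Pi.single x (Pi.single a 1))))⁺,
    ⟨fun x a ↦ posPart_nonneg _, fun x ↦ (Finset.sum_le_sum fun a _ ↦ ?_).trans (hφ x)⟩,
    fun x a ↦ (φ (WithLp.toLp 1 (Pi.single x (Pi.single a 1))))⁻,
    ⟨fun x a ↦ negPart_nonneg _, fun x ↦ (Finset.sum_le_sum fun a _ ↦ ?_).trans (hφ x)⟩,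
    fun x a ↦ (posPart_sub_negPart _).symm⟩
  · exact sup_le (le_abs_self _) (abs_nonneg _)
  · exact sup_le (neg_le_abs _) (abs_nonneg _)

theorem BellFunctional.injectiveNorm_le [DecidableEq X] [DecidableEq Y] [DecidableEq A]
    [DecidableEq B] (M : BellFunctional X Y A B) :
    injectiveNorm ℝ M.realTensor ≤ 4 * M.incValue := by
  refine iSup₂_le fun φ χ ↦ iSup₂_le fun hφ hχ ↦ ?_
  obtain ⟨p, hp, p', hp', hφp⟩ := exists_incompleteDist_sub hφ
  obtain ⟨q, hq, q', hq', hχq⟩ := exists_incompleteDist_sub hχ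
  have hle {p : X → A → ℝ} (hp : p ∈ incompleteDist X A) {q : Y → B → ℝ}
      (hq : q ∈ incompleteDist Y B) : ‖M.eval fun x y a b ↦ p x a * q y b‖ₑ ≤ M.incValue :=
    le_iSup₂_of_le _ (subset_convexHull ℝ _ ⟨p, hp, q, hq, rfl⟩) le_rfl
  rw [M.dualDistrib_realTensor]
  have hsplit : (M.eval fun x y a b ↦ φ (WithLp.toLp 1 (Pi.single x (Pi.single a 1))) *
        χ (WithLp.toLp 1 (Pi.single y (Pi.single b 1)))) =
      ((M.eval fun x y a b ↦ p x a * q y b) - M.eval fun x y a b ↦ p x a * q' y b) -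
        ((M.eval fun x y a b ↦ p' x a * q y b) - M.eval fun x y a b ↦ p' x a * q' y b) := by
    simp only [hφp, hχq, BellFunctional.eval, ← Finset.sum_sub_distrib]
    refine Finset.sum_congr rfl fun x _ ↦ Finset.sum_congr rfl fun y _ ↦
      Finset.sum_congr rfl fun a _ ↦ Finset.sum_congr rfl fun b _ ↦ ?_
    ring
  rw [hsplit]
  calc _ ≤ (M.incValue + M.incValue) + (M.incValue + M.incValue) :=
        enorm_sub_le.trans (add_le_add (enorm_sub_le.trans (add_le_add (hle hp hq) (hle hp hq')))
          (enorm_sub_le.trans (add_le_add (hle hp' hq) (hle hp' hq'))))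
    _ = 4 * M.incValue := by ring

end Classical

theorem mainTheorem5 {X Y A B : Type*} [Fintype X] [Fintype Y] [Fintype A] [Fintype B]
    [DecidableEq X] [DecidableEq Y] [DecidableEq A] [DecidableEq B]
    (M : BellFunctional X Y A B) :
    (M.incValue ≠ ⊤ ∧
      M.incValue ≤ injectiveNorm ℝ M.realTensor ∧
      injectiveNorm ℝ M.realTensor ≤ 4 * M.incValue) ∧
    (M.incEntangledValue ≠ ⊤ ∧
      M.incEntangledValue ≤ minNorm (l1LinfNorms X A) (l1LinfNorms Y B) M.complexTensor ∧
      minNorm (l1LinfNorms X A) (l1LinfNorms Y B) M.complexTensor ≤ 4 * M.incEntangledValue) := by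
  refine ⟨⟨?_, M.incValue_le_injectiveNorm, M.injectiveNorm_le⟩,
    M.incEntangledValue_ne_top, M.incEntangledValue_le_minNorm, M.minNorm_le⟩
  exact ne_top_of_le_ne_top ENNReal.ofReal_ne_top
    (iSup₂_le fun _ hP ↦ M.enorm_eval_le (incompleteClassical_subset_Icc hP))
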